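/- Work over $\mathbb{C}$. A *conic* $\beta$ is a plane section $\{h=0\}\cap\{Q=0\}\subset\mathbb{P}^3$, where $h$ is a plane and $Q$ a quadratic form not vanishing identically on $h$. It is counted with multiplicity, so $\beta$ is a smooth conic, a pair of distinct coplanar lines, or a double line. It is represented by its Chow form $L\mapsto Q(L\cap h)$, a quadratic form in the six Plücker coordinates of lines $L$, up to scaling. Let $\mathrm{Ch}=\mathrm{Ch}_{\mathrm{plane}}(2,\mathbb{P}^3)\subseteq\mathbb{P}^{20}$ be the set of these Chow forms. (A double line is determined by the line alone.) Fix $c\in\mathbb{P}^3$. For $\beta\in\mathrm{Ch}$ with $c\notin\beta$, let $c\vee\beta\in\mathbb{P}^9$ be the quadric with equation $\beta(c\vee X)=0$, where $\beta(L)$ is the Chow form of $\beta$ evaluated at the line $L$. Let $\mathcal B_c\subseteq\mathbb{P}^9$ be the Zariski closure of the set of these quadrics, and let $\overline\Gamma_c\subseteq \mathrm{Ch}\times\mathcal B_c$ be the Zariski closure of $\{(\beta,c\vee\beta):\beta\in\mathrm{Ch},\ c\notin\beta\}$. A *tangent plane* of a conic $\beta$ is a plane $H$ for which there is a point $P\in\beta\cap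 H$ such that either $P$ is a smooth point of $\beta$ and $H$ contains the tangent line of $\beta$ at $P$, or $P$ is a singular point of $\beta$ (the node of a pair of lines, or any point of a double line). For $B\in\mathcal B_c$ and $X\in B$, the *tangent plane* $T_XB$ is the embedded tangent space at $X$ of the reduced surface $B\subseteq\mathbb{P}^3$, when that space is a plane. "A pair of lines meeting at $c$" includes a double line through $c$. **(Lemma)** $\overline\Gamma_c$ is the set of all $(\beta,B)\in\mathrm{Ch}\times\mathcal B_c$ such that * $\beta\subseteq B$; * for every $X\in B$ with $X\ne c$, the line $c\vee X$ meets $\beta$; * for every $X\in B$ at which $B$ has a tangent plane, $T_XB$ is a tangent plane of $\beta$. **(Proposition)** Let $\beta\in\mathrm{Ch}$. 1. If $c\notin\beta$, then $c\vee\beta$ is well defined, and $(\beta,B)\in\overline\Gamma_c$ if and only if $B=c\vee\beta$. 2. If $c\in\beta$ and $\beta$ is not a pair of lines meeting at $c$, then $\beta$ spans a plane and has a unique tangent line $\ell$ at $c$. For $B\in\mathbb{P}^9$, $(\beta,B)\in\overline\Gamma_c$ if and only if the zero set of $B$ is the union of the plane spanned by $\beta$ and a plane $H\supseteq\ell$ (where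 $H$ may equal the plane spanned by $\beta$). 3. If $\beta$ is a pair of lines meeting at $c$, then $(\beta,B)\in\overline\Gamma_c$ if and only if $B\in\mathcal B_c$ and $\beta\subseteq B$. -/

import Mathlib

open scoped LinearAlgebra.Projectivization Matrix

namespace ConicCone

/-- Symmetric `n × n` complex matrices, i.e. quadratic forms `X ↦ Xᵀ A X` in `n` variables. -/
def symMat (n : ℕ) : Submodule ℂ (Matrix (Fin n) (Fin n) ℂ) where
  carrier := {A | A.IsSymm}
  add_mem' := fun ha hb => Matrix.IsSymm.add ha hb
  zero_mem' := Matrix.isSymm_zero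
  smul_mem' := fun k _ ha => Matrix.IsSymm.smul ha k

/-- The congruence `A ↦ Mᵀ A M`: the quadratic form `A` with the linear map `M` substituted. -/
def pullback {m n : ℕ} (M : Matrix (Fin m) (Fin n) ℂ) (A : symMat m) : symMat n :=
  ⟨Mᵀ * A.1 * M, by
    have h : (A.1)ᵀ = A.1 := A.2
    change (Mᵀ * A.1 * M)ᵀ = Mᵀ * A.1 * M
    rw [Matrix.transpose_mul, Matrix.transpose_mul, Matrix.transpose_transpose, h,
      Matrix.mul_assoc]⟩

/-- The value `Xᵀ A X`. -/
def qval {n : ℕ} (A : symMat n) (X : Fin n → ℂ) : ℂ := X ⬝ᵥ (A.1 *ᵥ X)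

/-- Projective three-space. -/
abbrev P3 := ℙ ℂ (Fin 4 → ℂ)

/-- `ℙ²⁰`: quadratic forms in the six Plücker coordinates of a line, up to scaling. -/
abbrev P20 := ℙ ℂ (symMat 6)

/-- `ℙ⁹`: quadrics in `ℙ³`. -/
abbrev P9 := ℙ ℂ (symMat 4)

/-- Plücker coordinates of the line through `X` and `Y`. -/
def pl (X Y : Fin 4 → ℂ) : Fin 6 → ℂ :=
  ![X 0 * Y 1 - X 1 * Y 0, X 0 * Y 2 - X 2 * Y 0, X 0 * Y 3 - X 3 * Y 0,
    X 1 * Y 2 - X 2 * Y 1, X 1 * Y 3 - X 3 * Y 1, X 2 * Y 3 - X 3 * Y 2]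

/-- The linear map sending the Plücker vector of a line to the point in which the line meets the
plane `h ⬝ X = 0`, see `meetMatrix_pl`. -/
def meetMatrix (h : Fin 4 → ℂ) : Matrix (Fin 4) (Fin 6) ℂ :=
  !![ h 1,  h 2,  h 3,    0,    0,    0;
     -h 0,    0,    0,  h 2,  h 3,    0;
        0, -h 0,    0, -h 1,    0,  h 3;
        0,    0, -h 0,    0, -h 1, -h 2]

theorem meetMatrix_pl (h X Y : Fin 4 → ℂ) :
    meetMatrix h *ᵥ pl X Y = (h ⬝ᵥ Y) • X - (h ⬝ᵥ X) • Y := by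
  ext i
  fin_cases i <;>
    simp [meetMatrix, pl, Matrix.mulVec, dotProduct, Fin.sum_univ_succ] <;> ring

/-- The matrix of `X ↦ c ∨ X` in Plücker coordinates, see `joinMatrix_mulVec`. -/
def joinMatrix (c : Fin 4 → ℂ) : Matrix (Fin 6) (Fin 4) ℂ :=
  !![c 1, -c 0,    0,    0;
     c 2,    0, -c 0,    0;
     c 3,    0,    0, -c 0;
       0,  c 2, -c 1,    0;
       0,  c 3,    0, -c 1;
       0,    0,  c 3, -c 2]

theorem joinMatrix_mulVec (c X : Fin 4 → ℂ) : joinMatrix c *ᵥ X = pl X c := by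
  ext i
  fin_cases i <;>
    simp [joinMatrix, pl, Matrix.mulVec, dotProduct, Fin.sum_univ_succ] <;> ring

/-! ### Plane conics and their Chow forms -/

/-- `β` is the Chow form of the conic cut out by the quadric `Q` in the plane `h ⬝ X = 0`: it
sends a line `L` to the value of `Q` at the point in which `L` meets the plane. Since
`meetMatrix h` maps onto the plane when `h ≠ 0`, the form is non-zero exactly when `h ≠ 0` and
`Q` does not vanish identically on the plane. -/
def IsSection (β : P20) (h : Fin 4 → ℂ) (Q : symMat 4) : Prop :=
  ∃ hne : pullback (meetMatrix h) Q ≠ 0,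
    β = Projectivization.mk ℂ (pullback (meetMatrix h) Q) hne

/-- The Chow variety of plane conics: smooth conics, pairs of distinct coplanar lines, and double
lines. The Chow form of a double line depends on the line only, not on a plane containing it. -/
def chPlane : Set P20 := {β | ∃ h Q, IsSection β h Q}

/-- The points of the curve with Chow form `β`: those `X` such that every line through `X`
annihilates the Chow form. -/
def curvePts (β : P20) : Set P3 := {X | ∀ Y : Fin 4 → ℂ, qval β.rep (pl X.rep Y) = 0}

/-- The embedded tangent space at `P` of the plane conic `h ⬝ X = 0`, `Q = 0`. It is a line at a
smooth point; at a singular point (the node of a line pair, any point of a double line) it is the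
whole plane. -/
def conicTangent (h : Fin 4 → ℂ) (Q : symMat 4) (P : Fin 4 → ℂ) :
    Submodule ℂ (Fin 4 → ℂ) where
  carrier := {Y | h ⬝ᵥ Y = 0 ∧ P ⬝ᵥ (Q.1 *ᵥ Y) = 0}
  add_mem' := by
    rintro a b ⟨ha, ha'⟩ ⟨hb, hb'⟩
    exact ⟨by rw [dotProduct_add, ha, hb, add_zero],
      by rw [Matrix.mulVec_add, dotProduct_add, ha', hb', add_zero]⟩
  zero_mem' := by simp
  smul_mem' := by
    rintro k a ⟨ha, ha'⟩
    exact ⟨by rw [dotProduct_smul, ha, smul_zero],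
      by rw [Matrix.mulVec_smul, dotProduct_smul, ha', smul_zero]⟩

/-- `ℓ` is the tangent line of the conic `β` at its smooth point `P`. -/
def IsTangentLine (β : P20) (P : P3) (ℓ : Submodule ℂ (Fin 4 → ℂ)) : Prop :=
  P ∈ curvePts β ∧ Module.finrank ℂ ℓ = 2 ∧ ∃ h Q, IsSection β h Q ∧ ℓ = conicTangent h Q P.rep

/-- The plane `H` is a tangent plane of the conic `β`: at some common point `P` it meets `β` with
multiplicity at least two, that is, either `P` is a smooth point of `β` whose tangent line lies in
`H`, or `P` is a singular point of `β`. -/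
def IsTangentPlane (β : P20) (H : Submodule ℂ (Fin 4 → ℂ)) : Prop :=
  Module.finrank ℂ H = 3 ∧
    ∃ P ∈ curvePts β, P.rep ∈ H ∧ ∃ h Q, IsSection β h Q ∧
      (conicTangent h Q P.rep ≤ H ∨ Module.finrank ℂ (conicTangent h Q P.rep) = 3)

/-- `β` is a union of two lines (possibly one line counted twice) that meet at `c`. -/
def IsLinePairAt (β : P20) (c : P3) : Prop :=
  ∃ L₁ L₂ : Submodule ℂ (Fin 4 → ℂ), Module.finrank ℂ L₁ = 2 ∧ Module.finrank ℂ L₂ = 2 ∧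
    c.rep ∈ L₁ ∧ c.rep ∈ L₂ ∧ ∀ X : P3, X ∈ curvePts β ↔ X.rep ∈ L₁ ∨ X.rep ∈ L₂

/-- The linear span of the curve. -/
def curveSpan (β : P20) : Submodule ℂ (Fin 4 → ℂ) :=
  Submodule.span ℂ {v | ∃ X ∈ curvePts β, v = X.rep}

/-! ### Cones and their tangent planes -/

/-- The points of the quadric `B`. -/
def quadricPts (B : P9) : Set P3 := {X | qval B.rep X.rep = 0}

/-- The embedded tangent space at `X` of the variety `B ⊆ ℙ³`: the common kernel of the
differentials at `X` of all polynomials that vanish on (the affine cone over) `B`. It is a plane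
exactly at the smooth points of the reduced surface `B`. -/
def tangentSpace (B : P9) (X : P3) : Submodule ℂ (Fin 4 → ℂ) where
  carrier := {Y | ∀ F : MvPolynomial (Fin 4) ℂ,
    (∀ Z : Fin 4 → ℂ, qval B.rep Z = 0 → MvPolynomial.eval Z F = 0) →
      ∑ i, MvPolynomial.eval X.rep (MvPolynomial.pderiv i F) * Y i = 0}
  add_mem' := by
    intro a b ha hb F hF
    simp only [Pi.add_apply, mul_add, Finset.sum_add_distrib, ha F hF, hb F hF, add_zero]
  zero_mem' := by intro F _; simp
  smul_mem' := by
    intro k a ha F hF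
    have h := ha F hF
    simp only [Pi.smul_apply, smul_eq_mul, mul_left_comm _ k, ← Finset.mul_sum, h, mul_zero]

/-- `B = c ∨ β`: the cone with equation `βᵀ ν₂(c ∨ X) = 0`, where this form is not zero. -/
def IsJoin (c : P3) (β : P20) (B : P9) : Prop :=
  ∃ hne : pullback (joinMatrix c.rep) β.rep ≠ 0,
    B = Projectivization.mk ℂ (pullback (joinMatrix c.rep) β.rep) hne

/-! ### Zariski closures, the cones `𝓑_c`, and the blowup -/

/-- Zariski closure in `ℙ⁹`. -/
def zariskiClosure (S : Set P9) : Set P9 :=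
  {B | ∀ (F : MvPolynomial (Fin 4 × Fin 4) ℂ) (d : ℕ), F.IsHomogeneous d →
    (∀ B' ∈ S, MvPolynomial.eval (fun ij => B'.rep.1 ij.1 ij.2) F = 0) →
      MvPolynomial.eval (fun ij => B.rep.1 ij.1 ij.2) F = 0}

/-- The matrix entries of a pair in `ℙ²⁰ × ℙ⁹`. -/
noncomputable def entries (p : P20 × P9) : (Fin 6 × Fin 6) ⊕ (Fin 4 × Fin 4) → ℂ :=
  Sum.elim (fun ij => p.1.rep.1 ij.1 ij.2) (fun ij => p.2.rep.1 ij.1 ij.2)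

/-- `F` is homogeneous of degree `d` in the entries of `β` and of degree `e` in those of `B`. -/
def IsBihomogeneous (F : MvPolynomial ((Fin 6 × Fin 6) ⊕ (Fin 4 × Fin 4)) ℂ) (d e : ℕ) : Prop :=
  F.IsWeightedHomogeneous (Sum.elim (fun _ => 1) (fun _ => 0)) d ∧
    F.IsWeightedHomogeneous (Sum.elim (fun _ => 0) (fun _ => 1)) e

/-- Zariski closure in `ℙ²⁰ × ℙ⁹`. -/
def zariskiClosure₂ (S : Set (P20 × P9)) : Set (P20 × P9) :=
  {p | ∀ (F : MvPolynomial ((Fin 6 × Fin 6) ⊕ (Fin 4 × Fin 4)) ℂ) (d e : ℕ),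
    IsBihomogeneous F d e → (∀ q ∈ S, MvPolynomial.eval (entries q) F = 0) →
      MvPolynomial.eval (entries p) F = 0}

/-- `𝓑_c`: the Zariski closure of the image of `β ↦ c ∨ β`. -/
def cones (c : P3) : Set P9 :=
  zariskiClosure {B | ∃ β ∈ chPlane, c ∉ curvePts β ∧ IsJoin c β B}

/-- The graph of `β ↦ c ∨ β` over the conics that do not meet `c`. -/
def joinGraph (c : P3) : Set (P20 × P9) :=
  {p | p.1 ∈ chPlane ∧ c ∉ curvePts p.1 ∧ IsJoin c p.1 p.2}

/-- The Zariski closure of the graph inside the product of the Chow variety and `𝓑_c`. -/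
def blowup (c : P3) : Set (P20 × P9) :=
  (chPlane ×ˢ cones c) ∩ zariskiClosure₂ (joinGraph c)

end ConicCone

open ConicCone

/-! The fibres of the closure over each `β` are computed explicitly and then compared with the three
geometric conditions. Fix a presentation `β = {h = 0, Q = 0}`. The cone form is `X ↦ Q(DX)` with `DX
= (h ⬝ c) X - (h ⬝ X) c`, the projection of `X` from `c` to the plane of `β` when that plane misses
`c`; the form vanishes identically exactly when `c ∈ β`. The set `cones c` is the linear space of
all quadrics singular at `c`, since each of them is the cone over its own section by a plane missing
`c` (`mem_cones_iff`).

Upper bounds on the fibres come from three families of bihomogeneous equations that hold on the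
graph. The minors of `B` against the cone form (`InClosure.join_proportional`) settle the case `c ∉
β`. The triangle equations give `β ⊆ B` (`InClosure.bil_self_eq_zero`). The wedge equations
(`InClosure.wedge_eq_zero`) retain the tangent direction: if `β` is smooth at `c`, then `β ⊆ B` and
the vertex at `c` force `B = h · m` for a linear form `m`, and the wedge equation puts the tangent
line `ℓ` into the plane of `m`.

Lower bounds come from paths into the graph and their limits (`inClosure_of_path`). At a smooth
point `c`, moving plane and quadric off `c` at independent speeds produces every `h · (a h + b Q(c,
·))`, hence every plane through `ℓ` (`inClosure_of_smooth`). If `β` is singular at `c`, a cone `B ⊇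
β` that cuts out `β` on `h` is reached by tilting `h`. The other cones are reached by perturbing
`B`, or, for a double line, by replacing `h` with another plane through the line
(`inClosure_of_linePair`).

For the comparison, off `c` the incidence conditions determine the zero set of `B`, hence `B` up to
scale. At a singular point `c`, containment suffices. At a smooth point `c`, the tangent plane of `B
= h · m` at a point of `m` outside `h` is `m` itself, and a tangent plane of `β` through `c` other
than the plane of `β` must contain `ℓ` (`mem_blowup_of_isAdapted_of_smooth`). -/

namespace ConicCone

/-! ### Symmetric bilinear forms -/

section Bilinear

variable {m n : ℕ}

/-- The bilinear form `Xᵀ A Y`. -/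
def bil (A : symMat n) (X Y : Fin n → ℂ) : ℂ := X ⬝ᵥ (A.1 *ᵥ Y)

theorem bil_comm (A : symMat n) (X Y : Fin n → ℂ) : bil A X Y = bil A Y X := by
  have h : (A.1)ᵀ = A.1 := A.2
  unfold bil
  rw [Matrix.dotProduct_mulVec, ← Matrix.mulVec_transpose, h, dotProduct_comm]

theorem bil_add_right (A : symMat n) (X Y Z : Fin n → ℂ) :
    bil A X (Y + Z) = bil A X Y + bil A X Z := by
  simp [bil, Matrix.mulVec_add]

theorem bil_add_left (A : symMat n) (X Y Z : Fin n → ℂ) :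
    bil A (X + Y) Z = bil A X Z + bil A Y Z := by
  simp [bil]

theorem bil_sub_right (A : symMat n) (X Y Z : Fin n → ℂ) :
    bil A X (Y - Z) = bil A X Y - bil A X Z := by
  simp [bil, Matrix.mulVec_sub]

theorem bil_sub_left (A : symMat n) (X Y Z : Fin n → ℂ) :
    bil A (X - Y) Z = bil A X Z - bil A Y Z := by
  simp [bil]

theorem bil_smul_right (A : symMat n) (k : ℂ) (X Y : Fin n → ℂ) :
    bil A X (k • Y) = k * bil A X Y := by
  simp [bil, Matrix.mulVec_smul]

theorem bil_smul_left (A : symMat n) (k : ℂ) (X Y : Fin n → ℂ) :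
    bil A (k • X) Y = k * bil A X Y := by
  simp [bil]

theorem bil_neg_right (A : symMat n) (X Y : Fin n → ℂ) :
    bil A X (-Y) = -bil A X Y := by
  simp [bil, Matrix.mulVec_neg]

theorem bil_neg_left (A : symMat n) (X Y : Fin n → ℂ) :
    bil A (-X) Y = -bil A X Y := by
  simp [bil]

theorem bil_zero_right (A : symMat n) (X : Fin n → ℂ) : bil A X 0 = 0 := by
  simp [bil]

theorem bil_zero_left (A : symMat n) (X : Fin n → ℂ) : bil A 0 X = 0 := by
  simp [bil]

theorem bil_smul (k : ℂ) (A : symMat n) (X Y : Fin n → ℂ) :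
    bil (k • A) X Y = k * bil A X Y := by
  simp [bil, Matrix.smul_mulVec]

theorem bil_add (A B : symMat n) (X Y : Fin n → ℂ) :
    bil (A + B) X Y = bil A X Y + bil B X Y := by
  simp [bil, Matrix.add_mulVec]

theorem qval_eq_bil (A : symMat n) (X : Fin n → ℂ) : qval A X = bil A X X := rfl

theorem bil_pullback (M : Matrix (Fin m) (Fin n) ℂ) (A : symMat m) (X Y : Fin n → ℂ) :
    bil (pullback M A) X Y = bil A (M *ᵥ X) (M *ᵥ Y) := by
  simp only [bil, pullback]
  rw [← Matrix.mulVec_mulVec, ← Matrix.mulVec_mulVec, Matrix.dotProduct_mulVec,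
    Matrix.vecMul_transpose]

theorem bil_eq_sum (A : symMat n) (X Y : Fin n → ℂ) :
    bil A X Y = ∑ i, ∑ j, X i * Y j * A.1 i j := by
  simp only [bil, dotProduct, Matrix.mulVec, Finset.mul_sum]
  refine Finset.sum_congr rfl fun i _ => Finset.sum_congr rfl fun j _ => ?_
  ring

/-- The symmetrised product `X ↦ 2 (u ⬝ X) (v ⬝ X)` of two linear forms. -/
def symProd (u v : Fin n → ℂ) : symMat n :=
  ⟨Matrix.vecMulVec u v + Matrix.vecMulVec v u, by
    change (_ + _)ᵀ = _
    rw [Matrix.transpose_add, Matrix.transpose_vecMulVec, Matrix.transpose_vecMulVec, add_comm]⟩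

theorem bil_symProd (u v X Y : Fin n → ℂ) :
    bil (symProd u v) X Y = (u ⬝ᵥ X) * (v ⬝ᵥ Y) + (v ⬝ᵥ X) * (u ⬝ᵥ Y) := by
  simp only [bil, symProd, Matrix.add_mulVec, dotProduct_add, Matrix.vecMulVec_mulVec]
  simp [dotProduct_comm X, mul_comm]

theorem bil_ext_of_qval {A A' : symMat n} (h : ∀ X, bil A X X = bil A' X X)
    (X Y : Fin n → ℂ) : bil A X Y = bil A' X Y := by
  have h1 := h (X + Y)
  simp only [bil_add_left, bil_add_right] at h1
  rw [bil_comm A Y X, bil_comm A' Y X, h X, h Y] at h1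
  linear_combination h1 / 2

theorem ext_of_bil {A A' : symMat n} (h : ∀ X Y, bil A X Y = bil A' X Y) : A = A' := by
  apply Subtype.ext
  ext i j
  have := h (Pi.single i 1) (Pi.single j 1)
  simpa [bil] using this

theorem ext_of_qval {A A' : symMat n} (h : ∀ X, bil A X X = bil A' X X) : A = A' :=
  ext_of_bil (bil_ext_of_qval h)

theorem exists_bil_self_ne_zero {A : symMat n} (h : A ≠ 0) : ∃ X, bil A X X ≠ 0 := by
  by_contra! hc
  refine h (ext_of_qval fun X => ?_)
  rw [hc X]
  simp [bil]

/-- A quadratic form that does not vanish at `v` has a zero on each translate of the line of `v`. -/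
theorem exists_bil_self_add_smul_eq_zero (A : symMat n) {v : Fin n → ℂ} (hv : bil A v v ≠ 0)
    (w : Fin n → ℂ) : ∃ s : ℂ, bil A (w + s • v) (w + s • v) = 0 := by
  obtain ⟨r, hr⟩ := IsAlgClosed.exists_pow_nat_eq
    (discrim (bil A v v) (2 * bil A v w) (bil A w w)) (n := 2) (by norm_num)
  obtain ⟨s, hs⟩ := exists_quadratic_eq_zero hv ⟨r, by rw [← hr, sq]⟩
  refine ⟨s, ?_⟩
  simp only [bil_add_left, bil_add_right, bil_smul_left, bil_smul_right]
  rw [bil_comm A w v]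
  linear_combination hs

/-- Quadratic forms with the same zeros are proportional. -/
theorem eq_smul_of_same_zeros {A A' : symMat n} (hA : A ≠ 0)
    (h : ∀ X, bil A X X = 0 ↔ bil A' X X = 0) : ∃ k : ℂ, k ≠ 0 ∧ A' = k • A := by
  obtain ⟨v, hv⟩ := exists_bil_self_ne_zero hA
  have hv' : bil A' v v ≠ 0 := fun h0 => hv ((h v).2 h0)
  refine ⟨bil A' v v / bil A v v, div_ne_zero hv' hv, ext_of_qval fun w => ?_⟩
  obtain ⟨r, hr⟩ := exists_bil_self_add_smul_eq_zero A hv w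
  have hr' := (h _).1 hr
  have e (C : symMat n) (s : ℂ) : bil C (w + s • v) (w + s • v) =
      bil C v v * s ^ 2 + 2 * bil C v w * s + bil C w w := by
    simp only [bil_add_left, bil_add_right, bil_smul_left, bil_smul_right]
    rw [bil_comm C w v]
    ring
  rw [e] at hr hr'
  -- By Vieta, `-b / a - r` is the other root, with multiplicity. On the line `w + s • v` both forms
  -- are quadratics with the same root set and the common root `r`, so their other roots agree as
  -- well, also for double roots.
  have root {a b c r : ℂ} (ha : a ≠ 0) (hr : a * r ^ 2 + b * r + c = 0) :
      a * (-b / a - r) ^ 2 + b * (-b / a - r) + c = 0 := by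
    field_simp
    linear_combination a * hr
  have fac {a b c r : ℂ} (ha : a ≠ 0) (hr : a * r ^ 2 + b * r + c = 0) (s : ℂ)
      (hs : a * s ^ 2 + b * s + c = 0) : s = r ∨ s = -b / a - r := by
    have : a * ((s - r) * (s - (-b / a - r))) = 0 := by
      field_simp
      linear_combination hs - hr
    rcases mul_eq_zero.1 ((mul_eq_zero.1 this).resolve_left ha) with h | h
    · exact Or.inl (sub_eq_zero.1 h)
    · exact Or.inr (sub_eq_zero.1 h)
  have h1 := root hv hr
  have h2 := root hv' hr'
  have h1' := (e A' _).symm.trans ((h _).1 ((e A _).trans h1))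
  have h2' := (e A _).symm.trans ((h _).2 ((e A' _).trans h2))
  have key : -(2 * bil A v w) / bil A v v - r = -(2 * bil A' v w) / bil A' v v - r := by
    rcases fac hv' hr' _ h1' with h3 | h3
    · rcases fac hv hr _ h2' with h4 | h4
      · rw [h3, h4]
      · exact h4.symm
    · exact h3
  rw [bil_smul]
  have key' : bil A v w * bil A' v v = bil A' v w * bil A v v := by
    field_simp at key
    linear_combination -key / 2
  field_simp
  linear_combination bil A v v * hr' - bil A' v v * hr + 2 * r * key'

/-- A quadric contained in the plane of a linear form is a multiple of the square of the form. -/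
theorem eq_sq_of_zeros_subset {A : symMat n} {t : Fin n → ℂ} (ht : t ≠ 0)
    (h : ∀ X, bil A X X = 0 → t ⬝ᵥ X = 0) :
    ∃ k : ℂ, k ≠ 0 ∧ ∀ X Y, bil A X Y = k * ((t ⬝ᵥ X) * (t ⬝ᵥ Y)) := by
  obtain ⟨v, hv⟩ : ∃ v, t ⬝ᵥ v = 1 := by
    obtain ⟨i, hi⟩ := Function.ne_iff.1 ht
    exact ⟨Pi.single i (t i)⁻¹, by simpa using mul_inv_cancel₀ hi⟩
  have hq : bil A v v ≠ 0 := fun h0 => by simpa [hv] using h v h0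
  -- The line `w + s • v` leaves the plane for `s ≠ 0`, so the quadratic in `s` has `0` as its only
  -- root and both lower coefficients vanish.
  have kill (w) (hw : t ⬝ᵥ w = 0) : bil A v w = 0 ∧ bil A w w = 0 := by
    have aux (s : ℂ) (hs : bil A (w + s • v) (w + s • v) = 0) : s = 0 := by
      simpa [dotProduct_add, hw, hv] using h _ hs
    obtain ⟨s, hs⟩ := exists_bil_self_add_smul_eq_zero A hq w
    have e (s : ℂ) : bil A (w + s • v) (w + s • v) =
        bil A v v * s ^ 2 + 2 * bil A v w * s + bil A w w := by
      simp only [bil_add_left, bil_add_right, bil_smul_left, bil_smul_right]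
      rw [bil_comm A w v]
      ring
    obtain rfl := aux s hs
    have hw0 : bil A w w = 0 := by simpa [e] using hs
    refine ⟨?_, hw0⟩
    have := aux (-(2 * bil A v w) / bil A v v) (by rw [e, hw0]; field_simp; ring)
    field_simp at this
    simpa using this
  refine ⟨bil A v v, hq, fun X Y => ?_⟩
  have hA : A = (bil A v v / 2) • symProd t t := ext_of_qval fun X => by
    obtain ⟨h1, h2⟩ := kill (X - (t ⬝ᵥ X) • v) (by simp [dotProduct_sub, hv])
    simp only [bil_sub_left, bil_sub_right, bil_smul_left, bil_smul_right] at h1 h2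
    rw [bil_smul, bil_symProd]
    rw [bil_comm A X v] at h2
    linear_combination h2 + 2 * (t ⬝ᵥ X) * h1
  conv_lhs => rw [hA, bil_smul, bil_symProd]
  ring

end Bilinear

/-! ### Planes and lines in the four-dimensional space -/

theorem exists_dotProduct_eq_one {n : ℕ} {h : Fin n → ℂ} (hh : h ≠ 0) : ∃ w, h ⬝ᵥ w = 1 := by
  obtain ⟨i, hi⟩ := Function.ne_iff.1 hh
  exact ⟨Pi.single i (h i)⁻¹, by simpa using mul_inv_cancel₀ hi⟩

theorem eq_of_dotProduct {n : ℕ} {h h' : Fin n → ℂ} (hh : ∀ X, h ⬝ᵥ X = h' ⬝ᵥ X) : h = h' := by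
  ext i
  simpa using hh (Pi.single i 1)

theorem exists_eq_smul_of_dotProduct {n : ℕ} {h m : Fin n → ℂ} (hh : h ≠ 0)
    (hm : ∀ Y, h ⬝ᵥ Y = 0 → m ⬝ᵥ Y = 0) : ∃ k : ℂ, m = k • h := by
  obtain ⟨w, hw⟩ := exists_dotProduct_eq_one hh
  refine ⟨m ⬝ᵥ w, eq_of_dotProduct fun X => ?_⟩
  have := hm (X - (h ⬝ᵥ X) • w) (by simp [dotProduct_sub, hw])
  simp only [dotProduct_sub, dotProduct_smul, smul_dotProduct, smul_eq_mul] at this ⊢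
  linear_combination this

theorem exists_eq_smul_add_smul_of_dotProduct {n : ℕ} {h q m v : Fin n → ℂ} (hh : h ≠ 0)
    (hv : h ⬝ᵥ v = 0) (hqv : q ⬝ᵥ v ≠ 0)
    (hm : ∀ Y, h ⬝ᵥ Y = 0 → q ⬝ᵥ Y = 0 → m ⬝ᵥ Y = 0) : ∃ a b : ℂ, m = a • h + b • q := by
  obtain ⟨w, hw⟩ := exists_dotProduct_eq_one hh
  refine ⟨m ⬝ᵥ w - m ⬝ᵥ v / (q ⬝ᵥ v) * (q ⬝ᵥ w), m ⬝ᵥ v / (q ⬝ᵥ v), eq_of_dotProduct fun X => ?_⟩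
  have := hm (X - (h ⬝ᵥ X) • w - ((q ⬝ᵥ X - (h ⬝ᵥ X) * (q ⬝ᵥ w)) / (q ⬝ᵥ v)) • v)
    (by simp [dotProduct_sub, hw, hv])
    (by simp only [dotProduct_sub, dotProduct_smul, smul_eq_mul]; field_simp; ring)
  simp only [dotProduct_sub, dotProduct_smul, smul_dotProduct, smul_eq_mul,
    add_dotProduct] at this ⊢
  linear_combination this

/-- The plane `h ⬝ X = 0`. -/
def plane (h : Fin 4 → ℂ) : Submodule ℂ (Fin 4 → ℂ) := LinearMap.ker (dotProductEquiv ℂ (Fin 4) h)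

theorem mem_plane {h X : Fin 4 → ℂ} : X ∈ plane h ↔ h ⬝ᵥ X = 0 := by
  simp [plane]

theorem finrank_plane {h : Fin 4 → ℂ} (hh : h ≠ 0) : Module.finrank ℂ (plane h) = 3 := by
  have h1 : dotProductEquiv ℂ (Fin 4) h ≠ 0 := by simpa using hh
  have h2 := Module.Dual.finrank_ker_add_one_of_ne_zero h1
  rw [Module.finrank_fin_fun] at h2
  unfold plane
  omega

theorem three_le_finrank_plane (h : Fin 4 → ℂ) : 3 ≤ Module.finrank ℂ (plane h) := by
  by_cases hh : h = 0
  · have : plane h = ⊤ := by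
      ext X
      simp [mem_plane, hh]
    rw [this, finrank_top, Module.finrank_fin_fun]
    norm_num
  · rw [finrank_plane hh]

theorem exists_eq_plane {H : Submodule ℂ (Fin 4 → ℂ)} (hH : Module.finrank ℂ H = 3) :
    ∃ h : Fin 4 → ℂ, h ≠ 0 ∧ H = plane h := by
  have hlt : H < ⊤ := by
    rw [lt_top_iff_ne_top]
    rintro rfl
    rw [finrank_top, Module.finrank_fin_fun] at hH
    norm_num at hH
  obtain ⟨f, hf, hle⟩ := Submodule.exists_le_ker_of_lt_top H hlt
  have hp : (dotProductEquiv ℂ (Fin 4)) ((dotProductEquiv ℂ (Fin 4)).symm f) = f :=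
    LinearEquiv.apply_symm_apply _ _
  have h0 : (dotProductEquiv ℂ (Fin 4)).symm f ≠ 0 := by simpa using hf
  refine ⟨_, h0, Submodule.eq_of_le_of_finrank_eq ?_ ?_⟩
  · rwa [plane, hp]
  · rw [hH, finrank_plane h0]

theorem finrank_plane_inf_plane {h m v : Fin 4 → ℂ} (hh : h ≠ 0) (hv : h ⬝ᵥ v = 0)
    (hm : m ⬝ᵥ v ≠ 0) : Module.finrank ℂ (plane h ⊓ plane m : Submodule ℂ (Fin 4 → ℂ)) = 2 := by
  have h1 := Submodule.finrank_sup_add_finrank_inf_eq (plane h) (plane m)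
  have h2 : Module.finrank ℂ (plane h ⊔ plane m : Submodule ℂ (Fin 4 → ℂ)) ≤ 4 := by
    simpa using Submodule.finrank_le (plane h ⊔ plane m)
  have h3 := three_le_finrank_plane m
  have h4 := finrank_plane hh
  have h5 : plane h ⊓ plane m < plane h :=
    lt_of_le_of_ne inf_le_left fun he => hm (mem_plane.1 (inf_eq_left.1 he (mem_plane.2 hv)))
  have h6 := Submodule.finrank_lt_finrank_of_lt h5
  omega

theorem exists_mem_plane_not_mem_span {h : Fin 4 → ℂ} (hh : h ≠ 0) (v : Fin 4 → ℂ) :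
    ∃ w, h ⬝ᵥ w = 0 ∧ ∀ s : ℂ, w ≠ s • v := by
  by_contra! hc
  have hle : plane h ≤ Submodule.span ℂ {v} := fun w hw => by
    obtain ⟨s, hs⟩ := hc w (mem_plane.1 hw)
    rw [hs]
    exact Submodule.smul_mem _ _ (Submodule.mem_span_singleton_self v)
  have h1 := Submodule.finrank_mono hle
  rw [finrank_plane hh] at h1
  have h2 := finrank_span_le_card (R := ℂ) ({v} : Set (Fin 4 → ℂ))
  simp only [Set.toFinset_singleton, Finset.card_singleton] at h2
  omega

/-! ### Projective points -/

theorem exists_rep_eq_smul {v : Fin 4 → ℂ} (hv : v ≠ 0) :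
    ∃ (P : P3) (a : ℂ), a ≠ 0 ∧ P.rep = a • v := by
  obtain ⟨a, ha⟩ := Projectivization.exists_smul_eq_mk_rep ℂ v hv
  exact ⟨_, a, a.ne_zero, ha.symm⟩

theorem eq_of_smul_rep {X Y : P3} {a b : ℂ} (ha : a ≠ 0) (h : a • X.rep = b • Y.rep) : X = Y := by
  rw [← X.mk_rep, ← Y.mk_rep, Projectivization.mk_eq_mk_iff']
  exact ⟨a⁻¹ * b, by rw [mul_smul, ← h, smul_smul, inv_mul_cancel₀ ha, one_smul]⟩

/-! ### Sections -/

theorem bil_section (h : Fin 4 → ℂ) (Q : symMat 4) (X Y Z W : Fin 4 → ℂ) :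
    bil (pullback (meetMatrix h) Q) (pl X Y) (pl Z W) =
      bil Q ((h ⬝ᵥ Y) • X - (h ⬝ᵥ X) • Y) ((h ⬝ᵥ W) • Z - (h ⬝ᵥ Z) • W) := by
  rw [bil_pullback, meetMatrix_pl, meetMatrix_pl]

theorem bil_join (c : Fin 4 → ℂ) (S : symMat 6) (X Y : Fin 4 → ℂ) :
    bil (pullback (joinMatrix c) S) X Y = bil S (pl X c) (pl Y c) := by
  rw [bil_pullback, joinMatrix_mulVec, joinMatrix_mulVec]

theorem section_ne_zero_iff {h : Fin 4 → ℂ} {Q : symMat 4} :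
    pullback (meetMatrix h) Q ≠ 0 ↔ h ≠ 0 ∧ ∃ v, h ⬝ᵥ v = 0 ∧ bil Q v v ≠ 0 := by
  constructor
  · intro hne
    refine ⟨?_, ?_⟩
    · rintro rfl
      refine hne (ext_of_bil fun X Y => ?_)
      have : meetMatrix 0 = 0 := by
        ext i j
        fin_cases i <;> fin_cases j <;> simp [meetMatrix]
      rw [bil_pullback, this]
      simp [bil]
    · obtain ⟨L, hL⟩ := exists_bil_self_ne_zero hne
      rw [bil_pullback] at hL
      -- The image of `meetMatrix h` lies in the plane for every vector `L`, decomposable or not.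
      refine ⟨_, ?_, hL⟩
      simp [meetMatrix, Matrix.mulVec, dotProduct, Fin.sum_univ_succ]
      ring
  · rintro ⟨hh, v, hv, hQ⟩ h0
    obtain ⟨w, hw⟩ := exists_dotProduct_eq_one hh
    have := bil_section h Q v w v w
    rw [h0, hv, hw] at this
    simp only [one_smul, zero_smul, sub_zero] at this
    apply hQ
    rw [← this]
    simp [bil]

theorem IsSection.exists_rep {β : P20} {h : Fin 4 → ℂ} {Q : symMat 4} (hs : IsSection β h Q) :
    ∃ a : ℂ, a ≠ 0 ∧ β.rep = a • pullback (meetMatrix h) Q := by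
  obtain ⟨hne, rfl⟩ := hs
  obtain ⟨a, ha⟩ := Projectivization.exists_smul_eq_mk_rep ℂ _ hne
  exact ⟨a, a.ne_zero, ha.symm⟩

theorem IsSection.ne_zero {β : P20} {h : Fin 4 → ℂ} {Q : symMat 4} (hs : IsSection β h Q) :
    h ≠ 0 := (section_ne_zero_iff.1 hs.1).1

theorem IsSection.exists_ne_zero {β : P20} {h : Fin 4 → ℂ} {Q : symMat 4} (hs : IsSection β h Q) :
    ∃ v, h ⬝ᵥ v = 0 ∧ bil Q v v ≠ 0 := (section_ne_zero_iff.1 hs.1).2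

/-- Chow forms only depend on the restriction of the quadric to the plane. -/
theorem section_congr {h : Fin 4 → ℂ} {Q Q' : symMat 4} {k : ℂ}
    (hQ : ∀ v, h ⬝ᵥ v = 0 → bil Q' v v = k * bil Q v v) :
    pullback (meetMatrix h) Q' = k • pullback (meetMatrix h) Q := by
  refine ext_of_qval fun L => ?_
  rw [bil_smul, bil_pullback, bil_pullback]
  refine hQ _ ?_
  simp [meetMatrix, Matrix.mulVec, dotProduct, Fin.sum_univ_succ]
  ring

/-- Two test lines suffice. If `X` is off the plane, join it to a point `v` of the plane with `Q(v)
≠ 0`: the line meets the plane at `v`. If `X` is in the plane, join it to a point outside: the line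
meets the plane at `X`. -/
theorem IsSection.mem_curvePts {β : P20} {h : Fin 4 → ℂ} {Q : symMat 4} (hs : IsSection β h Q)
    (X : P3) : X ∈ curvePts β ↔ h ⬝ᵥ X.rep = 0 ∧ bil Q X.rep X.rep = 0 := by
  obtain ⟨a, ha, hrep⟩ := hs.exists_rep
  have e (Y : Fin 4 → ℂ) : qval β.rep (pl X.rep Y) =
      a * bil Q ((h ⬝ᵥ Y) • X.rep - (h ⬝ᵥ X.rep) • Y) ((h ⬝ᵥ Y) • X.rep - (h ⬝ᵥ X.rep) • Y) := by
    rw [qval_eq_bil, hrep, bil_smul, bil_section]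
  change (∀ Y, qval β.rep (pl X.rep Y) = 0) ↔ _
  constructor
  · intro hX
    have hX' (Y : Fin 4 → ℂ) := (mul_eq_zero.1 ((e Y).symm.trans (hX Y))).resolve_left ha
    have h0 : h ⬝ᵥ X.rep = 0 := by
      by_contra h0
      obtain ⟨v, hv, hQ⟩ := hs.exists_ne_zero
      have := hX' v
      rw [hv] at this
      simp only [zero_smul, zero_sub, bil_neg_left, bil_neg_right, bil_smul_left,
        bil_smul_right] at this
      simp [h0, hQ] at this
    refine ⟨h0, ?_⟩
    obtain ⟨w, hw⟩ := exists_dotProduct_eq_one hs.ne_zero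
    have := hX' w
    rw [h0, hw] at this
    simpa using this
  · rintro ⟨h1, h2⟩ Y
    rw [e, h1]
    simp only [zero_smul, sub_zero, bil_smul_left, bil_smul_right, h2, mul_zero]

theorem IsSection.exists_mem_curvePts {β : P20} {h : Fin 4 → ℂ} {Q : symMat 4}
    (hs : IsSection β h Q) {v : Fin 4 → ℂ} (hv : v ≠ 0) (h1 : h ⬝ᵥ v = 0) (h2 : bil Q v v = 0) :
    ∃ P ∈ curvePts β, ∃ a : ℂ, a ≠ 0 ∧ P.rep = a • v := by
  obtain ⟨P, a, ha, hP⟩ := exists_rep_eq_smul hv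
  refine ⟨P, (hs.mem_curvePts P).2 ?_, a, ha, hP⟩
  rw [hP]
  simp [h1, h2, bil_smul_left, bil_smul_right]

theorem IsSection.curvePts_nonempty {β : P20} {h : Fin 4 → ℂ} {Q : symMat 4}
    (hs : IsSection β h Q) : ∃ P, P ∈ curvePts β := by
  obtain ⟨v, hv, hQ⟩ := hs.exists_ne_zero
  obtain ⟨w, hw, hwv⟩ := exists_mem_plane_not_mem_span hs.ne_zero v
  obtain ⟨s, hs0⟩ := exists_bil_self_add_smul_eq_zero Q hQ w
  obtain ⟨P, hP, -⟩ := hs.exists_mem_curvePts (v := w + s • v)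
    (fun h0 => hwv (-s) (by rw [neg_smul]; exact eq_neg_of_add_eq_zero_left h0))
    (by simp [dotProduct_add, hw, hv]) hs0
  exact ⟨P, hP⟩

theorem mem_conicTangent {h : Fin 4 → ℂ} {Q : symMat 4} {P Y : Fin 4 → ℂ} :
    Y ∈ conicTangent h Q P ↔ h ⬝ᵥ Y = 0 ∧ bil Q P Y = 0 := Iff.rfl

theorem bil_eq_dotProduct (Q : symMat 4) (P Y : Fin 4 → ℂ) :
    bil Q P Y = (Q.1 *ᵥ P) ⬝ᵥ Y := by
  rw [bil_comm, bil, dotProduct_comm]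

theorem conicTangent_eq_inf (h : Fin 4 → ℂ) (Q : symMat 4) (P : Fin 4 → ℂ) :
    conicTangent h Q P = plane h ⊓ plane (Q.1 *ᵥ P) := by
  ext Y
  rw [mem_conicTangent, Submodule.mem_inf, mem_plane, mem_plane, bil_eq_dotProduct]

theorem finrank_conicTangent_eq_two {h v P : Fin 4 → ℂ} {Q : symMat 4} (hh : h ≠ 0)
    (hv : h ⬝ᵥ v = 0) (hQ : bil Q P v ≠ 0) : Module.finrank ℂ (conicTangent h Q P) = 2 := by
  rw [conicTangent_eq_inf]
  exact finrank_plane_inf_plane hh hv (by rwa [← bil_eq_dotProduct])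

theorem conicTangent_eq_plane {h P : Fin 4 → ℂ} {Q : symMat 4}
    (hQ : ∀ v, h ⬝ᵥ v = 0 → bil Q P v = 0) : conicTangent h Q P = plane h := by
  ext Y
  rw [mem_conicTangent, mem_plane]
  exact ⟨fun h => h.1, fun h => ⟨h, hQ Y h⟩⟩

theorem finrank_conicTangent_eq_three_iff {h P : Fin 4 → ℂ} {Q : symMat 4} (hh : h ≠ 0) :
    Module.finrank ℂ (conicTangent h Q P) = 3 ↔ ∀ v, h ⬝ᵥ v = 0 → bil Q P v = 0 := by
  constructor
  · intro h3 v hv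
    by_contra hc
    rw [finrank_conicTangent_eq_two hh hv hc] at h3
    norm_num at h3
  · intro h
    rw [conicTangent_eq_plane h, finrank_plane hh]

/-! ### Bihomogeneous polynomials -/

/-- The matrix entries of a pair of symmetric matrices. -/
def pairEntries (S : symMat 6) (B : symMat 4) : (Fin 6 × Fin 6) ⊕ (Fin 4 × Fin 4) → ℂ :=
  Sum.elim (fun ij => S.1 ij.1 ij.2) (fun ij => B.1 ij.1 ij.2)

theorem eval_mul_of_isWeightedHomogeneous {σ : Type*} {w : σ → ℕ} {F : MvPolynomial σ ℂ} {d : ℕ}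
    (hF : F.IsWeightedHomogeneous w d) (k : ℂ) (x : σ → ℂ) :
    MvPolynomial.eval (fun i => k ^ w i * x i) F = k ^ d * MvPolynomial.eval x F := by
  rw [MvPolynomial.eval_eq, MvPolynomial.eval_eq, Finset.mul_sum]
  refine Finset.sum_congr rfl fun s hs => ?_
  have hw := hF (MvPolynomial.mem_support_iff.1 hs)
  rw [Finsupp.weight_apply, Finsupp.sum] at hw
  have : ∏ i ∈ s.support, (k ^ w i * x i) ^ s i = k ^ d * ∏ i ∈ s.support, x i ^ s i := by
    simp_rw [mul_pow, Finset.prod_mul_distrib, ← pow_mul]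
    rw [Finset.prod_pow_eq_pow_sum, ← hw]
    simp [mul_comm]
  rw [this]
  ring

theorem eval_smul_smul {F : MvPolynomial ((Fin 6 × Fin 6) ⊕ (Fin 4 × Fin 4)) ℂ} {d e : ℕ}
    (hF : IsBihomogeneous F d e) (a b : ℂ) (S : symMat 6) (B : symMat 4) :
    MvPolynomial.eval (pairEntries (a • S) (b • B)) F =
      a ^ d * b ^ e * MvPolynomial.eval (pairEntries S B) F := by
  have h1 := eval_mul_of_isWeightedHomogeneous hF.1 a (pairEntries S (b • B))
  have h2 := eval_mul_of_isWeightedHomogeneous hF.2 b (pairEntries S B)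
  rw [mul_assoc, ← h2]
  have e2 : (fun i => b ^ (Sum.elim (fun _ => 0) (fun _ => 1) i : ℕ) * pairEntries S B i) =
      pairEntries S (b • B) := by
    funext i
    rcases i with i | i <;> simp [pairEntries]
  have e1 : (fun i => a ^ (Sum.elim (fun _ => 1) (fun _ => 0) i : ℕ) * pairEntries S (b • B) i) =
      pairEntries (a • S) (b • B) := by
    funext i
    rcases i with i | i <;> simp [pairEntries]
  rw [e2, ← h1, e1]

theorem IsBihomogeneous.mul {F G : MvPolynomial ((Fin 6 × Fin 6) ⊕ (Fin 4 × Fin 4)) ℂ}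
    {d e d' e' : ℕ} (hF : IsBihomogeneous F d e) (hG : IsBihomogeneous G d' e') :
    IsBihomogeneous (F * G) (d + d') (e + e') :=
  ⟨hF.1.mul hG.1, hF.2.mul hG.2⟩

theorem IsBihomogeneous.add {F G : MvPolynomial ((Fin 6 × Fin 6) ⊕ (Fin 4 × Fin 4)) ℂ}
    {d e : ℕ} (hF : IsBihomogeneous F d e) (hG : IsBihomogeneous G d e) :
    IsBihomogeneous (F + G) d e :=
  ⟨hF.1.add hG.1, hF.2.add hG.2⟩

theorem IsBihomogeneous.sub {F G : MvPolynomial ((Fin 6 × Fin 6) ⊕ (Fin 4 × Fin 4)) ℂ}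
    {d e : ℕ} (hF : IsBihomogeneous F d e) (hG : IsBihomogeneous G d e) :
    IsBihomogeneous (F - G) d e :=
  ⟨hF.1.sub hG.1, hF.2.sub hG.2⟩

theorem IsBihomogeneous.C_mul {F : MvPolynomial ((Fin 6 × Fin 6) ⊕ (Fin 4 × Fin 4)) ℂ}
    {d e : ℕ} (hF : IsBihomogeneous F d e) (k : ℂ) :
    IsBihomogeneous (MvPolynomial.C k * F) d e :=
  ⟨hF.1.C_mul k, hF.2.C_mul k⟩

theorem IsBihomogeneous.sum {ι : Type*} (s : Finset ι)
    (F : ι → MvPolynomial ((Fin 6 × Fin 6) ⊕ (Fin 4 × Fin 4)) ℂ)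
    {d e : ℕ} (hF : ∀ i, IsBihomogeneous (F i) d e) :
    IsBihomogeneous (∑ i ∈ s, F i) d e :=
  ⟨MvPolynomial.IsWeightedHomogeneous.sum s F d fun i _ => (hF i).1,
    MvPolynomial.IsWeightedHomogeneous.sum s F e fun i _ => (hF i).2⟩

/-- The entry `S(L, M)` as a polynomial. -/
noncomputable def polyS (L M : Fin 6 → ℂ) :
    MvPolynomial ((Fin 6 × Fin 6) ⊕ (Fin 4 × Fin 4)) ℂ :=
  ∑ i, ∑ j, MvPolynomial.C (L i * M j) * MvPolynomial.X (Sum.inl (i, j))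

/-- The entry `B(X, Y)` as a polynomial. -/
noncomputable def polyB (X Y : Fin 4 → ℂ) :
    MvPolynomial ((Fin 6 × Fin 6) ⊕ (Fin 4 × Fin 4)) ℂ :=
  ∑ i, ∑ j, MvPolynomial.C (X i * Y j) * MvPolynomial.X (Sum.inr (i, j))

theorem eval_polyS (S : symMat 6) (B : symMat 4) (L M : Fin 6 → ℂ) :
    MvPolynomial.eval (pairEntries S B) (polyS L M) = bil S L M := by
  simp [polyS, bil_eq_sum, pairEntries]

theorem eval_polyB (S : symMat 6) (B : symMat 4) (X Y : Fin 4 → ℂ) :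
    MvPolynomial.eval (pairEntries S B) (polyB X Y) = bil B X Y := by
  simp [polyB, bil_eq_sum, pairEntries]

theorem isBihomogeneous_polyS (L M : Fin 6 → ℂ) : IsBihomogeneous (polyS L M) 1 0 := by
  refine IsBihomogeneous.sum _ _ fun i => IsBihomogeneous.sum _ _ fun j =>
    IsBihomogeneous.C_mul ⟨?_, ?_⟩ _
  · exact MvPolynomial.isWeightedHomogeneous_X ℂ _ _
  · exact MvPolynomial.isWeightedHomogeneous_X ℂ _ _

theorem isBihomogeneous_polyB (X Y : Fin 4 → ℂ) : IsBihomogeneous (polyB X Y) 0 1 := by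
  refine IsBihomogeneous.sum _ _ fun i => IsBihomogeneous.sum _ _ fun j =>
    IsBihomogeneous.C_mul ⟨?_, ?_⟩ _
  · exact MvPolynomial.isWeightedHomogeneous_X ℂ _ _
  · exact MvPolynomial.isWeightedHomogeneous_X ℂ _ _

/-! ### The closure of the graph, on representatives -/

/-- All bihomogeneous polynomials that vanish on the graph vanish at `(S, B)`. -/
def InClosure (c : P3) (S : symMat 6) (B : symMat 4) : Prop :=
  ∀ (F : MvPolynomial ((Fin 6 × Fin 6) ⊕ (Fin 4 × Fin 4)) ℂ) (d e : ℕ), IsBihomogeneous F d e →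
    (∀ q ∈ joinGraph c, MvPolynomial.eval (entries q) F = 0) →
      MvPolynomial.eval (pairEntries S B) F = 0

theorem mem_zariskiClosure₂_iff {c : P3} {β : P20} {B : P9} :
    (β, B) ∈ zariskiClosure₂ (joinGraph c) ↔ InClosure c β.rep B.rep := Iff.rfl

theorem InClosure.smul {c : P3} {S : symMat 6} {B : symMat 4} (h : InClosure c S B) (a b : ℂ) :
    InClosure c (a • S) (b • B) := by
  intro F d e hF hv
  rw [eval_smul_smul hF, h F d e hF hv, mul_zero]

theorem InClosure.of_smul {c : P3} {S : symMat 6} {B : symMat 4} {a b : ℂ} (ha : a ≠ 0)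
    (hb : b ≠ 0) (h : InClosure c (a • S) (b • B)) : InClosure c S B := by
  have := h.smul a⁻¹ b⁻¹
  rwa [smul_smul, smul_smul, inv_mul_cancel₀ ha, inv_mul_cancel₀ hb, one_smul, one_smul] at this

open Filter Topology in
/-- Limits along continuous paths of points of the Zariski closure lie in the Zariski closure. -/
theorem inClosure_of_path {c : P3} {S : ℂ → symMat 6} {B : ℂ → symMat 4}
    (hS : ∀ i j, Continuous fun t => (S t).1 i j) (hB : ∀ i j, Continuous fun t => (B t).1 i j)
    (h0 : B 0 ≠ 0) (h : ∀ t ≠ 0, B t ≠ 0 → InClosure c (S t) (B t)) :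
    InClosure c (S 0) (B 0) := by
  intro F d e hF hv
  have hc : Continuous fun t => MvPolynomial.eval (pairEntries (S t) (B t)) F := by
    refine (MvPolynomial.continuous_eval F).comp (continuous_pi fun i => ?_)
    rcases i with i | i
    · exact hS i.1 i.2
    · exact hB i.1 i.2
  -- A nonzero entry of `B 0` stays nonzero nearby, so `B t` represents a point of projective space
  -- on a punctured neighbourhood of `0`.
  obtain ⟨i, j, hij⟩ : ∃ i j, (B 0).1 i j ≠ 0 := by
    by_contra! h1
    exact h0 (Subtype.ext (Matrix.ext h1))
  have hev : ∀ᶠ t in 𝓝[≠] (0 : ℂ), MvPolynomial.eval (pairEntries (S t) (B t)) F = 0 := by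
    have h1 : ∀ᶠ t in 𝓝[≠] (0 : ℂ), (B t).1 i j ≠ 0 :=
      ((hB i j).continuousAt.eventually_ne hij).filter_mono nhdsWithin_le_nhds
    filter_upwards [h1, self_mem_nhdsWithin] with t ht ht0
    exact h t ht0 (fun hz => ht (by rw [hz]; rfl)) F d e hF hv
  have h1 : Tendsto (fun t => MvPolynomial.eval (pairEntries (S t) (B t)) F) (𝓝[≠] (0 : ℂ))
      (𝓝 (MvPolynomial.eval (pairEntries (S 0) (B 0)) F)) :=
    hc.continuousAt.tendsto.mono_left nhdsWithin_le_nhds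
  have h2 : Tendsto (fun t => MvPolynomial.eval (pairEntries (S t) (B t)) F) (𝓝[≠] (0 : ℂ))
      (𝓝 0) := tendsto_const_nhds.congr' (hev.mono fun t ht => ht.symm)
  exact tendsto_nhds_unique h1 h2

/-! ### Cones with vertex `c` -/

theorem mem_curvePts_iff_join {c : P3} {β : P20} :
    c ∈ curvePts β ↔ pullback (joinMatrix c.rep) β.rep = 0 := by
  have key (Y : Fin 4 → ℂ) : bil (pullback (joinMatrix c.rep) β.rep) Y Y =
      qval β.rep (pl c.rep Y) := by
    have : pl Y c.rep = - pl c.rep Y := by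
      ext i
      fin_cases i <;> simp [pl] <;> ring
    rw [bil_join, qval_eq_bil, this, bil_neg_left, bil_neg_right, neg_neg]
  change (∀ Y, qval β.rep (pl c.rep Y) = 0) ↔ _
  constructor
  · intro h
    refine ext_of_qval fun Y => ?_
    rw [key, h]
    simp [bil]
  · intro h Y
    rw [← key, h]
    simp [bil]

/-- Chow forms of conics that miss `c`, together with their cones, belong to the graph. -/
theorem mem_joinGraph_of_join {c : P3} {h : Fin 4 → ℂ} {Q : symMat 4} {B : symMat 4} {k : ℂ}
    (hk : k ≠ 0) (hB : B ≠ 0)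
    (hJ : pullback (joinMatrix c.rep) (pullback (meetMatrix h) Q) = k • B) :
    ∃ hS : pullback (meetMatrix h) Q ≠ 0,
      (Projectivization.mk ℂ (pullback (meetMatrix h) Q) hS, Projectivization.mk ℂ B hB) ∈
        joinGraph c := by
  have hS : pullback (meetMatrix h) Q ≠ 0 := by
    intro h0
    rw [h0] at hJ
    refine smul_ne_zero hk hB (hJ.symm.trans (ext_of_bil fun X Y => ?_))
    rw [bil_pullback]
    simp [bil]
  obtain ⟨a, ha⟩ := Projectivization.exists_smul_eq_mk_rep ℂ _ hS
  have hJ' : pullback (joinMatrix c.rep)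
      (Projectivization.mk ℂ (pullback (meetMatrix h) Q) hS).rep = ((a : ℂ) * k) • B := by
    rw [mul_smul, ← hJ, ← ha]
    refine ext_of_bil fun X Y => ?_
    change bil (pullback _ ((a : ℂ) • _)) X Y = _
    rw [bil_smul, bil_pullback, bil_pullback, bil_smul]
  have hne : ((a : ℂ) * k) • B ≠ 0 := smul_ne_zero (mul_ne_zero a.ne_zero hk) hB
  refine ⟨hS, ⟨h, Q, hS, rfl⟩, ?_, ?_⟩
  · rw [mem_curvePts_iff_join, hJ']
    exact hne
  · refine ⟨by rw [hJ']; exact hne, ?_⟩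
    rw [Projectivization.mk_eq_mk_iff']
    exact ⟨((a : ℂ) * k)⁻¹, by
      rw [hJ', smul_smul, inv_mul_cancel₀ (mul_ne_zero a.ne_zero hk), one_smul]⟩

theorem inClosure_of_join {c : P3} {h : Fin 4 → ℂ} {Q : symMat 4} {B : symMat 4} {k : ℂ}
    (hk : k ≠ 0) (hB : B ≠ 0)
    (hJ : pullback (joinMatrix c.rep) (pullback (meetMatrix h) Q) = k • B) :
    InClosure c (pullback (meetMatrix h) Q) B := by
  obtain ⟨hS, hmem⟩ := mem_joinGraph_of_join hk hB hJ
  obtain ⟨a, ha⟩ := Projectivization.exists_smul_eq_mk_rep ℂ _ hS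
  obtain ⟨b, hb⟩ := Projectivization.exists_smul_eq_mk_rep ℂ _ hB
  refine InClosure.of_smul a.ne_zero b.ne_zero fun F d e _ hv => ?_
  have := hv _ hmem
  change MvPolynomial.eval (pairEntries (Projectivization.mk ℂ _ hS).rep
    (Projectivization.mk ℂ _ hB).rep) F = 0 at this
  rw [← ha, ← hb] at this
  exact this

/-- The quadratic form of the cone over a plane section. -/
theorem bil_join_section (c h : Fin 4 → ℂ) (Q : symMat 4) (X Y : Fin 4 → ℂ) :
    bil (pullback (joinMatrix c) (pullback (meetMatrix h) Q)) X Y =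
      bil Q ((h ⬝ᵥ c) • X - (h ⬝ᵥ X) • c) ((h ⬝ᵥ c) • Y - (h ⬝ᵥ Y) • c) := by
  rw [bil_join, bil_section]

/-- Being singular at `c` is a linear, hence closed, condition, and joins satisfy it because `c ∨ c
= 0`. Conversely, a quadric singular at `c` is the cone over its section by a plane `k` with `k ⬝ c
= 1`. -/
theorem mem_cones_iff {c : P3} {B : P9} : B ∈ cones c ↔ ∀ Y, bil B.rep c.rep Y = 0 := by
  constructor
  · intro hB Y
    have hom : (∑ i, ∑ j, MvPolynomial.C (c.rep i * Y j) * MvPolynomial.X (i, j) :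
        MvPolynomial (Fin 4 × Fin 4) ℂ).IsHomogeneous 1 :=
      MvPolynomial.IsHomogeneous.sum _ _ _ fun i _ => MvPolynomial.IsHomogeneous.sum _ _ _
        fun j _ => (MvPolynomial.isHomogeneous_X ℂ _).C_mul _
    have e (B' : P9) : MvPolynomial.eval (fun ij => B'.rep.1 ij.1 ij.2)
        (∑ i, ∑ j, MvPolynomial.C (c.rep i * Y j) * MvPolynomial.X (i, j) :
          MvPolynomial (Fin 4 × Fin 4) ℂ) = bil B'.rep c.rep Y := by
      simp [bil_eq_sum]
    have := hB _ 1 hom ?_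
    · rwa [e] at this
    · rintro B' ⟨β, -, -, hne, rfl⟩
      obtain ⟨a, ha⟩ := Projectivization.exists_smul_eq_mk_rep ℂ _ hne
      have h1 : bil (Projectivization.mk ℂ _ hne).rep c.rep Y = 0 := by
        rw [← ha]
        change bil ((a : ℂ) • _) _ _ = 0
        have h2 : pl c.rep c.rep = 0 := by
          ext i
          fin_cases i <;> simp [pl] <;> ring
        rw [bil_smul, bil_join, h2, bil_zero_left, mul_zero]
      rwa [e]
  · intro hB
    obtain ⟨k, hk⟩ := exists_dotProduct_eq_one c.rep_nonzero
    have hk' : k ⬝ᵥ c.rep = 1 := by rwa [dotProduct_comm]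
    have hJ : pullback (joinMatrix c.rep) (pullback (meetMatrix k) B.rep) = (1 : ℂ) • B.rep := by
      refine ext_of_bil fun X Y => ?_
      rw [bil_join_section, one_smul, hk']
      simp [bil_sub_left, bil_sub_right, bil_smul_left, bil_smul_right, hB, bil_comm _ X c.rep]
    obtain ⟨hS, h1, h2, h3⟩ := mem_joinGraph_of_join one_ne_zero B.rep_nonzero hJ
    intro F d _ hv
    refine hv B ⟨_, h1, h2, ?_⟩
    have h4 : Projectivization.mk ℂ B.rep B.rep_nonzero = B := B.mk_rep
    dsimp only at h3
    rwa [h4] at h3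

/-! ### Equations of the closure -/

/-- A bihomogeneous polynomial that vanishes at the Chow forms of plane sections and their cones
vanishes on the closure of the graph. -/
theorem InClosure.eval_eq_zero {c : P3} {S : symMat 6} {B : symMat 4} (hSB : InClosure c S B)
    {F : MvPolynomial ((Fin 6 × Fin 6) ⊕ (Fin 4 × Fin 4)) ℂ} {d e : ℕ} (hF : IsBihomogeneous F d e)
    (h : ∀ (h : Fin 4 → ℂ) (Q : symMat 4), MvPolynomial.eval (pairEntries
      (pullback (meetMatrix h) Q) (pullback (joinMatrix c.rep) (pullback (meetMatrix h) Q))) F = 0) :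
    MvPolynomial.eval (pairEntries S B) F = 0 := by
  refine hSB F d e hF ?_
  rintro ⟨β, B'⟩ ⟨⟨m, Q, hs⟩, -, hne, hB'⟩
  dsimp only at hs hne hB'
  subst hB'
  obtain ⟨a, ha⟩ := Projectivization.exists_smul_eq_mk_rep ℂ _ hne
  obtain ⟨b, -, hb⟩ := hs.exists_rep
  change MvPolynomial.eval (pairEntries β.rep (Projectivization.mk ℂ _ hne).rep) F = 0
  have e1 : (Projectivization.mk ℂ _ hne).rep = ((a : ℂ) * b) •
      pullback (joinMatrix c.rep) (pullback (meetMatrix m) Q) := by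
    rw [← ha]
    change (a : ℂ) • pullback (joinMatrix c.rep) β.rep = _
    rw [mul_smul]
    congr 1
    refine ext_of_bil fun X Y => ?_
    rw [bil_smul, bil_pullback, bil_pullback, hb, bil_smul]
  rw [e1, hb, eval_smul_smul hF, h, mul_zero]

/-- The 2 × 2 minors of `B` against the cone form of `S` vanish on the graph. They determine `B` up
to scale wherever the cone form is nonzero. -/
theorem InClosure.join_proportional {c : P3} {S : symMat 6} {B : symMat 4}
    (hSB : InClosure c S B) (X Y Z W : Fin 4 → ℂ) :
    bil B X Y * bil (pullback (joinMatrix c.rep) S) Z W =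
      bil B Z W * bil (pullback (joinMatrix c.rep) S) X Y := by
  have := hSB.eval_eq_zero (F := polyB X Y * polyS (pl Z c.rep) (pl W c.rep) -
    polyB Z W * polyS (pl X c.rep) (pl Y c.rep)) (d := 0 + 1) (e := 1 + 0)
    (((isBihomogeneous_polyB _ _).mul (isBihomogeneous_polyS _ _)).sub
      ((isBihomogeneous_polyB _ _).mul (isBihomogeneous_polyS _ _))) ?_
  · rw [map_sub, map_mul, map_mul, eval_polyB, eval_polyB, eval_polyS, eval_polyS] at this
    rw [bil_join, bil_join]
    exact sub_eq_zero.1 this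
  · intro h Q
    rw [map_sub, map_mul, map_mul, eval_polyB, eval_polyB, eval_polyS, eval_polyS, bil_join,
      bil_join]
    ring

/-- For fixed `X`, the linear form `B(X, ·)` divides the two-form `S(X ∨ c, ·)`. -/
theorem InClosure.wedge_eq_zero {c : P3} {S : symMat 6} {B : symMat 4}
    (hSB : InClosure c S B) (X Y Z W : Fin 4 → ℂ) :
    bil B X Y * bil S (pl X c.rep) (pl Z W) + bil B X Z * bil S (pl X c.rep) (pl W Y) +
      bil B X W * bil S (pl X c.rep) (pl Y Z) = 0 := by
  have := hSB.eval_eq_zero (F := polyB X Y * polyS (pl X c.rep) (pl Z W) +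
    polyB X Z * polyS (pl X c.rep) (pl W Y) + polyB X W * polyS (pl X c.rep) (pl Y Z))
    (d := 0 + 1) (e := 1 + 0)
    ((((isBihomogeneous_polyB _ _).mul (isBihomogeneous_polyS _ _)).add
      ((isBihomogeneous_polyB _ _).mul (isBihomogeneous_polyS _ _))).add
      ((isBihomogeneous_polyB _ _).mul (isBihomogeneous_polyS _ _))) ?_
  · simpa only [map_add, map_mul, eval_polyB, eval_polyS] using this
  -- Let `q = Q(DX, ·)` with `DX = (h ⬝ c) X - (h ⬝ X) c`. The two-form `S(X ∨ c, ·)` is `q ∧ h`,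
  -- and `B(X, ·)` is a linear combination of `q` and `h`, so their wedge product is zero.
  · intro h Q
    simp only [map_add, map_mul, eval_polyB, eval_polyS, bil_section, bil_join_section]
    simp only [bil_sub_left, bil_sub_right, bil_smul_left, bil_smul_right]
    ring

/-- The Plücker vectors `u₁ ∧ u₂`, `u₂ ∧ u₀`, `u₀ ∧ u₁` of the edges of a triangle. -/
def edge (u : Fin 3 → Fin 4 → ℂ) : Fin 3 → Fin 6 → ℂ :=
  ![pl (u 1) (u 2), pl (u 2) (u 0), pl (u 0) (u 1)]

/-- A plane `H` with basis `u` meets the conic in two points. On the dual of `H` the Chow form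
restricts to the product `R` of these points, and `R B R = ½ tr (B R) R` says that `B` vanishes
at both. -/
theorem InClosure.triangle {c : P3} {S : symMat 6} {B : symMat 4}
    (hSB : InClosure c S B) (u : Fin 3 → Fin 4 → ℂ) (i j : Fin 3) :
    2 * ∑ k, ∑ l, bil S (edge u i) (edge u k) * bil B (u k) (u l) *
      bil S (edge u l) (edge u j) =
      ∑ k, ∑ l, bil S (edge u i) (edge u j) * bil B (u k) (u l) *
        bil S (edge u l) (edge u k) := by
  have := hSB.eval_eq_zero (F :=
    MvPolynomial.C 2 * ∑ k, ∑ l, polyS (edge u i) (edge u k) * polyB (u k) (u l) *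
      polyS (edge u l) (edge u j) -
    ∑ k, ∑ l, polyS (edge u i) (edge u j) * polyB (u k) (u l) * polyS (edge u l) (edge u k))
    (d := 1 + 0 + 1) (e := 0 + 1 + 0)
    ((IsBihomogeneous.C_mul (IsBihomogeneous.sum _ _ fun k => IsBihomogeneous.sum _ _ fun l =>
      ((isBihomogeneous_polyS _ _).mul (isBihomogeneous_polyB _ _)).mul
        (isBihomogeneous_polyS _ _)) _).sub
      (IsBihomogeneous.sum _ _ fun k => IsBihomogeneous.sum _ _ fun l =>
      ((isBihomogeneous_polyS _ _).mul (isBihomogeneous_polyB _ _)).mul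
        (isBihomogeneous_polyS _ _))) ?_
  · simp only [map_sub, map_mul, map_sum, eval_polyB, eval_polyS, MvPolynomial.eval_C] at this
    exact sub_eq_zero.1 this
  · intro h Q
    simp only [map_sub, map_mul, map_sum, eval_polyB, eval_polyS, MvPolynomial.eval_C]
    simp only [Fin.sum_univ_three]
    have hB (k l : Fin 3) : bil (pullback (joinMatrix c.rep) (pullback (meetMatrix h) Q))
        (u k) (u l) = (h ⬝ᵥ c.rep) * ((h ⬝ᵥ c.rep) * bil Q (u k) (u l) -
          (h ⬝ᵥ u k) * bil Q c.rep (u l) - (h ⬝ᵥ u l) * bil Q c.rep (u k)) +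
          (h ⬝ᵥ u k) * (h ⬝ᵥ u l) * bil Q c.rep c.rep := by
      rw [bil_join_section]
      simp only [bil_sub_left, bil_sub_right, bil_smul_left, bil_smul_right]
      rw [bil_comm Q (u k) c.rep]
      ring
    simp only [hB]
    have c10 := bil_comm Q (u 1) (u 0)
    have c20 := bil_comm Q (u 2) (u 0)
    have c21 := bil_comm Q (u 2) (u 1)
    fin_cases i <;> fin_cases j <;>
    · simp only [edge, Fin.isValue, Fin.zero_eta, Fin.mk_one, Fin.reduceFinMk,
        Matrix.cons_val_zero, Matrix.cons_val_one, Matrix.cons_val, bil_section,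
        bil_sub_left, bil_sub_right, bil_smul_left, bil_smul_right, c10, c20, c21]
      ring

/-- On the closure of the graph, the quadric contains the conic. -/
theorem InClosure.bil_self_eq_zero {c : P3} {h : Fin 4 → ℂ} {Q B : symMat 4}
    (hSB : InClosure c (pullback (meetMatrix h) Q) B) (hne : pullback (meetMatrix h) Q ≠ 0)
    {P : Fin 4 → ℂ} (hP : h ⬝ᵥ P = 0) (hQ : bil Q P P = 0) : bil B P P = 0 := by
  obtain ⟨hh, f, hf, hQf⟩ := section_ne_zero_iff.1 hne
  obtain ⟨w, hw⟩ := exists_dotProduct_eq_one hh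
  -- The triangle meets the plane `h` in the edge `P ∨ f`; its other edges meet it in `f` and in
  -- `P`. Since `Q(P, P) = 0`, the (1,1) equation is `2 Q(P, f)² B(P, P) = 0`. If `Q(P, f) = 0`, the
  -- (0,0) equation becomes `Q(f, f)² B(P, P) = 0`, and `Q(f, f) ≠ 0`.
  have h00 := hSB.triangle ![P, f, w] 0 0
  have h11 := hSB.triangle ![P, f, w] 1 1
  simp only [edge, Fin.sum_univ_three, Fin.isValue, Matrix.cons_val_zero, Matrix.cons_val_one,
    Matrix.cons_val, bil_section, hP, hf, hw, hQ, zero_smul, one_smul, sub_zero, zero_sub,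
    bil_neg_left, bil_neg_right, bil_zero_left, bil_zero_right, sub_self, mul_zero, zero_mul,
    add_zero, neg_zero] at h00 h11
  rw [bil_comm Q f P, bil_comm B f P] at h00
  rw [bil_comm Q f P] at h11
  by_cases hr : bil Q P f = 0
  · rw [hr] at h00
    have : bil Q f f ^ 2 * bil B P P = 0 := by linear_combination h00
    simpa [hQf] using this
  · have : bil Q P f ^ 2 * bil B P P = 0 := by linear_combination h11 / 2
    simpa [hr] using this

/-! ### Bases of planes -/

theorem finrank_span_pair_eq_two {x y : Fin 4 → ℂ} (hx : x ≠ 0) (hy : ∀ s : ℂ, y ≠ s • x) :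
    Module.finrank ℂ (Submodule.span ℂ {x, y}) = 2 := by
  have hli : LinearIndependent ℂ ![x, y] :=
    (LinearIndependent.pair_iff' hx).2 fun a => (hy a).symm
  have := finrank_span_eq_card hli
  rwa [Matrix.range_cons, Matrix.range_cons, Matrix.range_empty, Set.union_empty,
    Set.singleton_union, Fintype.card_fin] at this

theorem exists_plane_frame {h c v : Fin 4 → ℂ} (hh : h ≠ 0) (hc : h ⬝ᵥ c = 0) (hv : h ⬝ᵥ v = 0)
    (hc0 : c ≠ 0) (hcv : ∀ s : ℂ, v ≠ s • c) :
    ∃ w, h ⬝ᵥ w = 0 ∧ (∀ s t : ℂ, w ≠ s • c + t • v) ∧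
      ∀ X, h ⬝ᵥ X = 0 → ∃ x y z : ℂ, X = x • c + y • v + z • w := by
  have h2 := finrank_span_pair_eq_two hc0 hcv
  have h3 := finrank_plane hh
  have hle : Submodule.span ℂ {c, v} ≤ plane h := by
    rw [Submodule.span_le]
    rintro _ (rfl | rfl)
    · exact mem_plane.2 hc
    · exact mem_plane.2 hv
  obtain ⟨w, hw, hw'⟩ : ∃ w ∈ plane h, w ∉ Submodule.span ℂ {c, v} := by
    by_contra! hall
    have := Submodule.finrank_mono (show plane h ≤ Submodule.span ℂ {c, v} from hall)
    omega
  refine ⟨w, mem_plane.1 hw, fun s t he => hw' (Submodule.mem_span_pair.2 ⟨s, t, he.symm⟩), ?_⟩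
  have hle' : Submodule.span ℂ {c, v, w} ≤ plane h := by
    rw [Submodule.span_le]
    rintro _ (rfl | rfl | rfl)
    · exact mem_plane.2 hc
    · exact mem_plane.2 hv
    · exact hw
  have hlt : Submodule.span ℂ {c, v} < Submodule.span ℂ {c, v, w} := by
    refine lt_of_le_of_ne (Submodule.span_mono ?_) ?_
    · rintro _ (rfl | rfl) <;> simp
    · intro he
      apply hw'
      rw [he]
      exact Submodule.subset_span (by simp)
  have h4 := Submodule.finrank_lt_finrank_of_lt hlt
  have he := Submodule.eq_of_le_of_finrank_le hle' (by omega)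
  intro X hX
  have hX' := mem_plane.2 hX
  rw [← he, Submodule.mem_span_triple] at hX'
  obtain ⟨x, y, z, hxyz⟩ := hX'
  exact ⟨x, y, z, hxyz.symm⟩

/-- A basis of the plane adapted to a conic that is singular at `c`. -/
theorem exists_isotropic_frame {h c : Fin 4 → ℂ} {Q : symMat 4}
    (hne : pullback (meetMatrix h) Q ≠ 0) (hc0 : c ≠ 0) (hc : h ⬝ᵥ c = 0) (hQ : bil Q c c = 0) :
    ∃ v e, h ⬝ᵥ v = 0 ∧ h ⬝ᵥ e = 0 ∧ bil Q v v ≠ 0 ∧ bil Q e e = 0 ∧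
      (∀ s t : ℂ, e ≠ s • c + t • v) ∧
      ∀ X, h ⬝ᵥ X = 0 → ∃ x y z : ℂ, X = x • c + y • v + z • e := by
  obtain ⟨hh, v, hv, hQv⟩ := section_ne_zero_iff.1 hne
  have hcv (s : ℂ) : v ≠ s • c := by
    rintro rfl
    simp [bil_smul_left, bil_smul_right, hQ] at hQv
  obtain ⟨w, hw, hwi, hspan⟩ := exists_plane_frame hh hc hv hc0 hcv
  obtain ⟨s, hs⟩ := exists_bil_self_add_smul_eq_zero Q hQv w
  refine ⟨v, w + s • v, hv, by simp [dotProduct_add, hw, hv], hQv, hs, ?_, ?_⟩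
  · intro a b he
    refine hwi a (b - s) ?_
    rw [sub_smul, eq_sub_of_add_eq he]
    abel
  · intro X hX
    obtain ⟨x, y, z, rfl⟩ := hspan X hX
    refine ⟨x, y - z * s, z, ?_⟩
    rw [sub_smul, mul_smul, smul_add]
    abel

/-! ### Degenerations -/

theorem continuous_section {h : ℂ → Fin 4 → ℂ} {Q : ℂ → symMat 4} (hh : Continuous h)
    (hQ : Continuous fun t => (Q t).1) (i j : Fin 6) :
    Continuous fun t => (pullback (meetMatrix (h t)) (Q t)).1 i j := by
  have hM : Continuous fun t => meetMatrix (h t) := by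
    refine continuous_matrix fun i j => ?_
    have h' (k : Fin 4) : Continuous fun t => h t k := (continuous_apply k).comp hh
    fin_cases i <;> fin_cases j <;>
      first
        | exact continuous_const
        | exact h' _
        | exact (h' _).neg
  exact ((hM.matrix_transpose.matrix_mul hQ).matrix_mul hM).matrix_elem i j

/-- Degenerations to a conic through `c`: the plane of the conic and a further plane. -/
theorem inClosure_of_smooth {c : P3} {h : Fin 4 → ℂ} {Q : symMat 4} (hc : h ⬝ᵥ c.rep = 0)
    (hQ : bil Q c.rep c.rep = 0) (a b : ℂ)
    (hB : a • symProd h h + b • symProd h (Q.1 *ᵥ c.rep) ≠ 0) :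
    InClosure c (pullback (meetMatrix h) Q) (a • symProd h h + b • symProd h (Q.1 *ᵥ c.rep)) := by
  obtain ⟨k, hk⟩ := exists_dotProduct_eq_one c.rep_nonzero
  rw [dotProduct_comm] at hk
  -- Chosen so that `H t ⬝ c = -t b` and `R t (c, c) = 2 t a`: plane and quadric leave `c` to first
  -- order at independent speeds. The cone form is then exactly `t • B t`, and dividing by `t`
  -- yields the required limit.
  set H : ℂ → Fin 4 → ℂ := fun t => h + (-(t * b)) • k with hH
  set R : ℂ → symMat 4 := fun t => Q + (t * a) • symProd k k with hR
  set B : ℂ → symMat 4 := fun t => (t * b ^ 2) • R t + a • symProd (H t) (H t) +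
    b • symProd (H t) ((R t).1 *ᵥ c.rep) with hBdef
  have hH0 : H 0 = h := by simp [hH]
  have hR0 : R 0 = Q := by simp [hR]
  have hB0 : B 0 = a • symProd h h + b • symProd h (Q.1 *ᵥ c.rep) := by
    simp only [hBdef, hH0, hR0, zero_mul, zero_smul, zero_add]
  have hHc : Continuous H := by fun_prop
  have hRc : Continuous fun t => (R t).1 := by
    have : (fun t => (R t).1) = fun t => Q.1 + (t * a) • (symProd k k).1 := by
      funext t
      rfl
    rw [this]
    fun_prop
  have key := inClosure_of_path (c := c) (S := fun t => pullback (meetMatrix (H t)) (R t)) (B := B)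
    (continuous_section hHc hRc) (fun i j => ?_) (by rwa [hB0]) (fun t ht hBt => ?_)
  · rwa [hB0, hH0, hR0] at key
  · have e : (fun t => (B t).1 i j) = fun t => (t * b ^ 2) * (R t).1 i j +
        a * (H t i * H t j + H t i * H t j) +
        b * (H t i * ((R t).1 *ᵥ c.rep) j + ((R t).1 *ᵥ c.rep) i * H t j) := by
      funext t
      simp [hBdef, symProd, Matrix.vecMulVec_apply]
      ring
    rw [e]
    have h1 (i) : Continuous fun t => H t i := (continuous_apply i).comp hHc
    have h2 : Continuous fun t => (R t).1 *ᵥ c.rep := hRc.matrix_mulVec continuous_const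
    have h3 (i) : Continuous fun t => ((R t).1 *ᵥ c.rep) i := (continuous_apply i).comp h2
    have h4 : Continuous fun t => (R t).1 i j := hRc.matrix_elem i j
    have := h1 i
    have := h1 j
    have := h3 i
    have := h3 j
    fun_prop
  · refine inClosure_of_join ht hBt (ext_of_qval fun X => ?_)
    have hHc' : H t ⬝ᵥ c.rep = -(t * b) := by simp [hH, add_dotProduct, hc, hk]
    have hRc' : bil (R t) c.rep c.rep = 2 * (t * a) := by
      simp only [hR, bil_add, hQ, bil_smul, bil_symProd, hk]
      ring
    rw [bil_join_section, bil_smul, hHc']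
    simp only [hBdef, bil_add, bil_smul, bil_symProd, ← bil_eq_dotProduct]
    simp only [bil_sub_left, bil_sub_right, bil_smul_left, bil_smul_right, hRc']
    rw [bil_comm (R t) X c.rep]
    ring

/-- Here `β = B ∩ h`. Tilt the plane to `h + t • k`, which misses `c`: the cone over `B ∩ (h + t •
k)` is the cone `B` itself, with form `t² B`, while the sections tend to `β`. -/
theorem inClosure_of_section_of_ne_zero {c : P3} {h : Fin 4 → ℂ} {Q B : symMat 4}
    (hc : h ⬝ᵥ c.rep = 0) (hBc : ∀ Y, bil B c.rep Y = 0) (hB : B ≠ 0) {μ : ℂ} (hμ : μ ≠ 0)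
    (hBQ : ∀ X, h ⬝ᵥ X = 0 → bil B X X = μ * bil Q X X) :
    InClosure c (pullback (meetMatrix h) Q) B := by
  obtain ⟨k, hk⟩ := exists_dotProduct_eq_one c.rep_nonzero
  rw [dotProduct_comm] at hk
  have key := inClosure_of_path (c := c)
    (S := fun t => pullback (meetMatrix (h + t • k)) B) (B := fun _ => B)
    (continuous_section (by fun_prop) continuous_const) (fun i j => continuous_const) hB
    (fun t ht _ => ?_)
  · simp only [zero_smul, add_zero] at key
    rw [section_congr hBQ] at key
    refine InClosure.of_smul hμ one_ne_zero ?_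
    rwa [one_smul]
  · refine inClosure_of_join (k := t ^ 2) (pow_ne_zero 2 ht) hB (ext_of_bil fun X Y => ?_)
    rw [bil_join_section, bil_smul]
    simp only [add_dotProduct, smul_dotProduct, hc, hk, smul_eq_mul, bil_sub_left, bil_sub_right,
      bil_smul_left, bil_smul_right, hBc, bil_comm B X c.rep]
    ring

theorem inClosure_of_section {c : P3} {h : Fin 4 → ℂ} {Q B : symMat 4}
    (hne : pullback (meetMatrix h) Q ≠ 0)
    (hc : h ⬝ᵥ c.rep = 0) (hQc : ∀ Y, h ⬝ᵥ Y = 0 → bil Q c.rep Y = 0)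
    (hBc : ∀ Y, bil B c.rep Y = 0) (hB : B ≠ 0) {μ : ℂ}
    (hBQ : ∀ X, h ⬝ᵥ X = 0 → bil B X X = μ * bil Q X X) :
    InClosure c (pullback (meetMatrix h) Q) B := by
  by_cases hμ : μ = 0
  swap
  · exact inClosure_of_section_of_ne_zero hc hBc hB hμ hBQ
  subst hμ
  obtain ⟨k, hk⟩ := exists_dotProduct_eq_one c.rep_nonzero
  rw [dotProduct_comm] at hk
  -- Now `B` contains the plane `h`. Projection along `c` to the plane `k` turns `Q` into a cone `R`
  -- with vertex `c` and the same restriction to `h`, so `B + t • R` cuts out `β` on `h` for `t ≠ 0`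
  -- and tends to `B`.
  set R : symMat 4 := pullback (1 - Matrix.vecMulVec c.rep k) Q with hR
  have hRv (X Y) : bil R X Y = bil Q (X - (k ⬝ᵥ X) • c.rep) (Y - (k ⬝ᵥ Y) • c.rep) := by
    rw [hR, bil_pullback]
    simp [Matrix.sub_mulVec, Matrix.vecMulVec_mulVec]
  have hRc (Y) : bil R c.rep Y = 0 := by
    rw [hRv, hk, one_smul, sub_self, bil_zero_left]
  have hRQ (X) (hX : h ⬝ᵥ X = 0) : bil R X X = bil Q X X := by
    rw [hRv]
    simp only [bil_sub_left, bil_sub_right, bil_smul_left, bil_smul_right, hQc X hX, hQc _ hc,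
      bil_comm Q X c.rep]
    ring
  obtain ⟨-, v, hv, hQv⟩ := section_ne_zero_iff.1 hne
  have key := inClosure_of_path (c := c)
    (S := fun _ => pullback (meetMatrix h) Q) (B := fun t => B + t • R)
    (fun i j => continuous_const) (fun i j => ?_) (by simpa using hB) (fun t ht hBt => ?_)
  · simpa using key
  · change Continuous fun t : ℂ => B.1 i j + t * R.1 i j
    fun_prop
  · refine inClosure_of_section_of_ne_zero hc (fun Y => ?_) hBt ht fun X hX => ?_
    · rw [bil_add, bil_smul, hBc, hRc, mul_zero, add_zero]
    · rw [bil_add, bil_smul, hBQ X hX, hRQ X hX, zero_mul, zero_add]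

/-- The double line on `h = m = 0` can be presented in either plane, because `h` at `L ∩ m` is minus
`m` at `L ∩ h`. -/
theorem section_symProd_swap (h m : Fin 4 → ℂ) :
    pullback (meetMatrix h) (symProd m m) = pullback (meetMatrix m) (symProd h h) := by
  refine ext_of_qval fun L => ?_
  have : h ⬝ᵥ (meetMatrix m *ᵥ L) = -(m ⬝ᵥ (meetMatrix h *ᵥ L)) := by
    simp [meetMatrix, Matrix.mulVec, dotProduct, Fin.sum_univ_succ]
    ring
  rw [bil_pullback, bil_pullback, bil_symProd, bil_symProd, this]
  ring

/-- Over a pair of lines through `c`, every quadric with vertex `c` that contains the lines is in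
the closure. -/
theorem inClosure_of_linePair {c : P3} {h : Fin 4 → ℂ} {Q B : symMat 4}
    (hne : pullback (meetMatrix h) Q ≠ 0)
    (hc : h ⬝ᵥ c.rep = 0) (hQc : ∀ Y, h ⬝ᵥ Y = 0 → bil Q c.rep Y = 0)
    (hBc : ∀ Y, bil B c.rep Y = 0) (hB : B ≠ 0)
    (hsub : ∀ P, h ⬝ᵥ P = 0 → bil Q P P = 0 → bil B P P = 0) :
    InClosure c (pullback (meetMatrix h) Q) B := by
  obtain ⟨v, e, hv, he, hQv, hQe, -, hspan⟩ :=
    exists_isotropic_frame hne c.rep_nonzero hc (hQc _ hc)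
  have hBe := hsub e he hQe
  have hQX (x y z : ℂ) : bil Q (x • c.rep + y • v + z • e) (x • c.rep + y • v + z • e) =
      y ^ 2 * bil Q v v + 2 * y * z * bil Q v e := by
    simp only [bil_add_left, bil_add_right, bil_smul_left, bil_smul_right, hQc _ hc, hQc v hv,
      hQc e he, hQe, bil_comm Q v c.rep, bil_comm Q e c.rep, bil_comm Q e v]
    ring
  have hBX (x y z : ℂ) : bil B (x • c.rep + y • v + z • e) (x • c.rep + y • v + z • e) =
      y ^ 2 * bil B v v + 2 * y * z * bil B v e := by
    simp only [bil_add_left, bil_add_right, bil_smul_left, bil_smul_right, hBc,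
      hBe, bil_comm B v c.rep, bil_comm B e c.rep, bil_comm B e v]
    ring
  by_cases hr : bil Q v e = 0
  · by_cases hb : bil B v e = 0
    · refine inClosure_of_section hne hc hQc hBc hB (μ := bil B v v / bil Q v v) fun X hX => ?_
      obtain ⟨x, y, z, rfl⟩ := hspan X hX
      rw [hQX, hBX, hr, hb]
      field_simp
      ring
    -- `β` is the double line on `c ∨ e`, but `B` cuts `h` in this line and another one. Replace `h`
    -- by the polar plane `m` of `e`, tangent to `B` along `c ∨ e`: on `m` the form `B` is a
    -- multiple of `h²`, and `β` is also presented by `h²` in `m`.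
    · have hm (Y) : (B.1 *ᵥ e) ⬝ᵥ Y = bil B e Y := (bil_eq_dotProduct B e Y).symm
      have hb' : bil B e v ≠ 0 := by rwa [bil_comm]
      set m := B.1 *ᵥ e with hmdef
      have hS : pullback (meetMatrix m) (symProd h h) =
          (2 * bil B v e ^ 2 / bil Q v v) • pullback (meetMatrix h) Q := by
        rw [← section_symProd_swap]
        refine section_congr fun X hX => ?_
        obtain ⟨x, y, z, rfl⟩ := hspan X hX
        rw [hQX, hr, bil_symProd, hm]
        simp only [bil_add_right, bil_smul_right, hBe, bil_comm B e c.rep, hBc, bil_comm B e v]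
        field_simp
        ring
      have hk : 2 * bil B v e ^ 2 / bil Q v v ≠ 0 :=
        div_ne_zero (mul_ne_zero two_ne_zero (pow_ne_zero 2 hb)) hQv
      have hmc : m ⬝ᵥ c.rep = 0 := by rw [hm, bil_comm, hBc]
      refine InClosure.of_smul hk one_ne_zero ?_
      rw [← hS, one_smul]
      obtain ⟨w, hw⟩ := exists_dotProduct_eq_one (section_ne_zero_iff.1 hne).1
      -- `w` is corrected along `v` to lie in `m` while keeping `h ⬝ u = 1`; then `c, e, u` span
      -- `m`.
      set u := w - (bil B e w / bil B e v) • v with hu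
      have hhu : h ⬝ᵥ u = 1 := by simp [hu, dotProduct_sub, hw, hv]
      have hBu : bil B e u = 0 := by
        rw [hu, bil_sub_right, bil_smul_right, div_mul_cancel₀ _ hb', sub_self]
      refine inClosure_of_section (by rw [hS]; exact smul_ne_zero hk hne) hmc
        (fun Y _ => by rw [bil_symProd, hc]; ring) hBc hB (μ := bil B u u / 2) fun X hX => ?_
      obtain ⟨x, y, z, hxyz⟩ := hspan (X - (h ⬝ᵥ X) • u) (by simp [dotProduct_sub, hhu])
      have hX' : X = x • c.rep + y • v + z • e + (h ⬝ᵥ X) • u := eq_add_of_sub_eq hxyz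
      set s := h ⬝ᵥ X with hs
      have hy : y = 0 := by
        rw [hm, hX'] at hX
        simp only [bil_add_right, bil_smul_right, hBe, bil_comm B e c.rep, hBc, hBu] at hX
        simpa [hb'] using hX
      rw [bil_symProd, ← hs, hX', hy]
      simp only [bil_add_left, bil_add_right, bil_smul_left, bil_smul_right, hBc, hBe, hBu,
        bil_comm B e c.rep, bil_comm B u c.rep, bil_comm B u e, zero_smul, bil_zero_left,
        bil_zero_right]
      ring
  · refine inClosure_of_section hne hc hQc hBc hB (μ := bil B v e / bil Q v e) fun X hX => ?_
    -- A point of the second line of `β`. As `B` contains both lines, its restriction to `h` is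
    -- proportional to `Q`.
    have h1 := hsub ((0 : ℂ) • c.rep + (2 * bil Q v e) • v + (-bil Q v v) • e)
      (by simp [dotProduct_add, hv, he]) (by rw [hQX]; ring)
    rw [hBX] at h1
    have h2 : bil Q v e * bil B v v = bil Q v v * bil B v e := by
      have : bil Q v e * (bil Q v e * bil B v v - bil Q v v * bil B v e) = 0 := by
        linear_combination h1 / 4
      exact sub_eq_zero.1 ((mul_eq_zero.1 this).resolve_left hr)
    obtain ⟨x, y, z, rfl⟩ := hspan X hX
    rw [hQX, hBX]
    field_simp
    linear_combination y ^ 2 * h2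

/-! ### Tangent spaces of quadrics -/

/-- The restriction of a polynomial to a parametrised line, and its derivative at the origin. -/
theorem exists_line_restriction {σ : Type*} [Fintype σ] (F : MvPolynomial σ ℂ) (X Y : σ → ℂ) :
    ∃ p : Polynomial ℂ, (∀ t, p.eval t = MvPolynomial.eval (X + t • Y) F) ∧
      p.derivative.eval 0 = ∑ i, MvPolynomial.eval X (MvPolynomial.pderiv i F) * Y i := by
  classical
  induction F using MvPolynomial.induction_on with
  | C a => exact ⟨Polynomial.C a, by simp, by simp⟩
  | add F G hF hG =>
    obtain ⟨p, hp, hp'⟩ := hF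
    obtain ⟨q, hq, hq'⟩ := hG
    exact ⟨p + q, fun t => by simp [hp, hq], by
      simp [hp', hq', add_mul, Finset.sum_add_distrib]⟩
  | mul_X F j hF =>
    obtain ⟨p, hp, hp'⟩ := hF
    have h0 : p.eval 0 = MvPolynomial.eval X F := by simpa using hp 0
    refine ⟨p * (Polynomial.C (X j) + Polynomial.C (Y j) * Polynomial.X),
      fun t => by simp [hp, mul_comm t], ?_⟩
    simp only [Polynomial.derivative_mul, Polynomial.derivative_C,
      Polynomial.derivative_X, Polynomial.eval_add, Polynomial.eval_mul, Polynomial.eval_C,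
      Polynomial.eval_X, hp', h0, MvPolynomial.pderiv_mul, map_add, map_mul, add_mul,
      Finset.sum_add_distrib, MvPolynomial.eval_X, MvPolynomial.pderiv_X, Pi.single_apply]
    simp only [Finset.sum_mul, mul_right_comm _ (X j)]
    simp

/-- The equation of `B` is itself one of the polynomials vanishing on `B`, and its derivative at `X`
along `Y` is `2 B(X, Y)`. This bounds the tangent space from above; lines contained in `B` bound it
from below, so the ideal of the reduced surface is never computed. -/
theorem bil_eq_zero_of_mem_tangentSpace {B : P9} {X : P3} {Y : Fin 4 → ℂ}
    (hY : Y ∈ tangentSpace B X) : bil B.rep X.rep Y = 0 := by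
  set F : MvPolynomial (Fin 4) ℂ := ∑ i, ∑ j,
    MvPolynomial.X i * MvPolynomial.X j * MvPolynomial.C (B.rep.1 i j) with hF
  have hev (Z) : MvPolynomial.eval Z F = bil B.rep Z Z := by
    simp [hF, bil_eq_sum]
  have h0 := hY F fun Z hZ => by rw [hev]; exact hZ
  obtain ⟨p, hp, hp'⟩ := exists_line_restriction F X.rep Y
  rw [← hp'] at h0
  have hpe : p = Polynomial.C (bil B.rep X.rep X.rep) +
      Polynomial.C (2 * bil B.rep X.rep Y) * Polynomial.X +
      Polynomial.C (bil B.rep Y Y) * Polynomial.X ^ 2 := by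
    refine Polynomial.funext fun t => ?_
    rw [hp, hev]
    simp only [bil_add_left, bil_add_right, bil_smul_left, bil_smul_right, Polynomial.eval_add,
      Polynomial.eval_mul, Polynomial.eval_C, Polynomial.eval_X, Polynomial.eval_pow]
    rw [bil_comm _ Y X.rep]
    ring
  rw [hpe] at h0
  simpa using h0

theorem mem_tangentSpace_of_line {B : P9} {X : P3} {Y : Fin 4 → ℂ}
    (hY : ∀ t : ℂ, bil B.rep (X.rep + t • Y) (X.rep + t • Y) = 0) : Y ∈ tangentSpace B X := by
  intro F hF
  obtain ⟨p, hp, hp'⟩ := exists_line_restriction F X.rep Y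
  have : p = 0 := Polynomial.funext fun t => by
    rw [hp, hF _ (hY t), Polynomial.eval_zero]
  rw [← hp', this]
  simp

theorem tangentSpace_le_plane (B : P9) (X : P3) : tangentSpace B X ≤ plane (B.rep.1 *ᵥ X.rep) :=
  fun _ hY => mem_plane.2 (by
    rw [← bil_eq_dotProduct]
    exact bil_eq_zero_of_mem_tangentSpace hY)

/-- At a smooth point the embedded tangent plane is the polar plane. -/
theorem tangentSpace_eq_plane {B : P9} {X : P3} (hX : B.rep.1 *ᵥ X.rep ≠ 0)
    (h3 : Module.finrank ℂ (tangentSpace B X) = 3) :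
    tangentSpace B X = plane (B.rep.1 *ᵥ X.rep) :=
  Submodule.eq_of_le_of_finrank_eq (tangentSpace_le_plane B X) (by rw [h3, finrank_plane hX])

/-- The tangent space at a singular point of the quadric contains the quadric. -/
theorem mem_tangentSpace_of_singular {B : P9} {X : P3} (hX : B.rep.1 *ᵥ X.rep = 0)
    {Z : Fin 4 → ℂ} (hZ : bil B.rep Z Z = 0) : Z ∈ tangentSpace B X := by
  have h0 (Y) : bil B.rep X.rep Y = 0 := by rw [bil_eq_dotProduct, hX, zero_dotProduct]
  refine mem_tangentSpace_of_line fun t => ?_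
  simp [bil_add_left, bil_add_right, bil_smul_left, bil_smul_right, h0, hZ, bil_comm _ Z X.rep]

/-- If a quadric has a tangent plane at a singular point, then it is a double plane. -/
theorem exists_eq_sq_of_singular {B : P9} {X : P3} (hX : B.rep.1 *ᵥ X.rep = 0)
    (h3 : Module.finrank ℂ (tangentSpace B X) = 3) :
    ∃ t, t ≠ 0 ∧ tangentSpace B X = plane t ∧
      ∃ k : ℂ, k ≠ 0 ∧ ∀ Y Z, bil B.rep Y Z = k * ((t ⬝ᵥ Y) * (t ⬝ᵥ Z)) := by
  obtain ⟨t, ht, hT⟩ := exists_eq_plane h3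
  refine ⟨t, ht, hT, eq_sq_of_zeros_subset ht fun Z hZ => ?_⟩
  rw [← mem_plane, ← hT]
  exact mem_tangentSpace_of_singular hX hZ

/-- The vertex of a cone lies in each of its tangent planes. -/
theorem vertex_mem_tangentSpace {B : P9} {c X : P3} (hBc : ∀ Y, bil B.rep c.rep Y = 0)
    (hX : X ∈ quadricPts B) : c.rep ∈ tangentSpace B X := by
  have hX' : bil B.rep X.rep X.rep = 0 := hX
  refine mem_tangentSpace_of_line fun t => ?_
  simp [bil_add_left, bil_add_right, bil_smul_left, bil_smul_right, hBc, hX', bil_comm _ X.rep]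

/-! ### The fibres of the closure of the graph -/

theorem IsSection.mem_blowup_iff {β : P20} {h : Fin 4 → ℂ} {Q : symMat 4} (hs : IsSection β h Q)
    (c : P3) (B : P9) : (β, B) ∈ blowup c ↔
      (∀ Y, bil B.rep c.rep Y = 0) ∧ InClosure c (pullback (meetMatrix h) Q) B.rep := by
  obtain ⟨a, ha, hrep⟩ := hs.exists_rep
  have h1 : InClosure c β.rep B.rep ↔ InClosure c (pullback (meetMatrix h) Q) B.rep := by
    rw [hrep]
    constructor
    · intro hi
      exact InClosure.of_smul ha one_ne_zero (by rwa [one_smul])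
    · intro hi
      simpa using hi.smul a 1
  rw [← h1, ← mem_cones_iff, ← mem_zariskiClosure₂_iff]
  exact ⟨fun hm => ⟨hm.1.2, hm.2⟩, fun hm => ⟨⟨⟨h, Q, hs⟩, hm.1⟩, hm.2⟩⟩

theorem IsSection.curvePts_subset_iff {β : P20} {h : Fin 4 → ℂ} {Q : symMat 4}
    (hs : IsSection β h Q) {B : P9} : curvePts β ⊆ quadricPts B ↔
      ∀ P, h ⬝ᵥ P = 0 → bil Q P P = 0 → bil B.rep P P = 0 := by
  constructor
  · intro hsub P h1 h2
    by_cases hP : P = 0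
    · rw [hP, bil_zero_left]
    obtain ⟨X, hX, a, ha, hXP⟩ := hs.exists_mem_curvePts hP h1 h2
    have h3 : bil B.rep X.rep X.rep = 0 := hsub hX
    rw [hXP, bil_smul_left, bil_smul_right] at h3
    simpa [ha] using h3
  · intro hsub X hX
    obtain ⟨h1, h2⟩ := (hs.mem_curvePts X).1 hX
    exact hsub _ h1 h2

theorem curvePts_subset_of_mem_blowup {c : P3} {β : P20} {B : P9} (hm : (β, B) ∈ blowup c) :
    curvePts β ⊆ quadricPts B := by
  obtain ⟨h, Q, hs⟩ := hm.1.1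
  exact hs.curvePts_subset_iff.2 fun P h1 h2 =>
    ((hs.mem_blowup_iff c B).1 hm).2.bil_self_eq_zero hs.1 h1 h2

/-- The three conditions that describe the closure of the graph. -/
def IsAdapted (c : P3) (β : P20) (B : P9) : Prop :=
  curvePts β ⊆ quadricPts B ∧
    ∀ X ∈ quadricPts B,
      (X ≠ c → ∃ P ∈ curvePts β, P.rep ∈ Submodule.span ℂ {c.rep, X.rep}) ∧
      (Module.finrank ℂ (tangentSpace B X) = 3 → IsTangentPlane β (tangentSpace B X))

/-! ### Conics that miss the vertex -/

section Miss

variable {c : P3} {β : P20} {h : Fin 4 → ℂ} {Q : symMat 4}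

theorem IsSection.join_ne_zero (hs : IsSection β h Q) (hc : c ∉ curvePts β) :
    pullback (joinMatrix c.rep) (pullback (meetMatrix h) Q) ≠ 0 := by
  obtain ⟨a, ha, hrep⟩ := hs.exists_rep
  intro h0
  refine hc (mem_curvePts_iff_join.2 (ext_of_bil fun X Y => ?_))
  have h1 : bil (pullback (joinMatrix c.rep) (pullback (meetMatrix h) Q)) X Y = 0 := by
    rw [h0]
    simp [bil]
  rw [hrep, bil_pullback, bil_smul, ← bil_pullback, h1]
  simp [bil]

/-- The cone form is nonzero at some `Z`, and the minors against the entry at `(Z, Z)` make `B` a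
multiple of it. -/
theorem IsSection.mem_blowup_iff_of_not_mem (hs : IsSection β h Q) (hc : c ∉ curvePts β) (B : P9) :
    (β, B) ∈ blowup c ↔ ∃ k : ℂ, k ≠ 0 ∧
      B.rep = k • pullback (joinMatrix c.rep) (pullback (meetMatrix h) Q) := by
  have hJ := hs.join_ne_zero hc
  rw [hs.mem_blowup_iff]
  constructor
  · rintro ⟨-, hcl⟩
    obtain ⟨Z, hZ⟩ := exists_bil_self_ne_zero hJ
    have e : B.rep = (bil B.rep Z Z /
        bil (pullback (joinMatrix c.rep) (pullback (meetMatrix h) Q)) Z Z) •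
          pullback (joinMatrix c.rep) (pullback (meetMatrix h) Q) := by
      refine ext_of_bil fun X Y => ?_
      have := hcl.join_proportional X Y Z Z
      rw [bil_smul]
      field_simp
      exact this
    refine ⟨_, ?_, e⟩
    intro h0
    rw [h0, zero_smul] at e
    exact B.rep_nonzero e
  · rintro ⟨k, hk, hB⟩
    constructor
    · intro Y
      rw [hB, bil_smul, bil_join_section]
      simp [bil_zero_left]
    · refine inClosure_of_join (inv_ne_zero hk) B.rep_nonzero ?_
      rw [hB, smul_smul, inv_mul_cancel₀ hk, one_smul]

theorem exists_isJoin (hs : IsSection β h Q) (hc : c ∉ curvePts β) :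
    ∃ B₀ : P9, IsJoin c β B₀ ∧ ∀ B : P9, (β, B) ∈ blowup c ↔ B = B₀ := by
  have hne : pullback (joinMatrix c.rep) β.rep ≠ 0 := fun h0 => hc (mem_curvePts_iff_join.2 h0)
  obtain ⟨a, ha, hrep⟩ := hs.exists_rep
  have hJ : pullback (joinMatrix c.rep) β.rep =
      a • pullback (joinMatrix c.rep) (pullback (meetMatrix h) Q) := by
    refine ext_of_bil fun X Y => ?_
    rw [hrep, bil_smul, bil_pullback, bil_pullback _ (pullback (meetMatrix h) Q), bil_smul]
  refine ⟨_, ⟨hne, rfl⟩, fun B => ?_⟩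
  rw [hs.mem_blowup_iff_of_not_mem hc]
  have hB : B = Projectivization.mk ℂ B.rep B.rep_nonzero := B.mk_rep.symm
  constructor
  · rintro ⟨k, hk, hBk⟩
    rw [hB, Projectivization.mk_eq_mk_iff']
    exact ⟨k * a⁻¹, by rw [hJ, smul_smul, mul_assoc, inv_mul_cancel₀ ha, mul_one, hBk]⟩
  · intro he
    rw [hB, Projectivization.mk_eq_mk_iff'] at he
    obtain ⟨b, hb⟩ := he
    rw [hJ, smul_smul] at hb
    refine ⟨b * a, ?_, hb.symm⟩
    intro h0
    rw [h0, zero_smul] at hb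
    exact B.rep_nonzero hb.symm

theorem isAdapted_of_mem_blowup_of_not_mem (hs : IsSection β h Q) (hc : c ∉ curvePts β) {B : P9}
    (hm : (β, B) ∈ blowup c) : IsAdapted c β B := by
  refine ⟨curvePts_subset_of_mem_blowup hm, fun X hX => ?_⟩
  obtain ⟨k, hk, hB⟩ := (hs.mem_blowup_iff_of_not_mem hc B).1 hm
  have hBv (Y Z) : bil B.rep Y Z = k * bil Q ((h ⬝ᵥ c.rep) • Y - (h ⬝ᵥ Y) • c.rep)
      ((h ⬝ᵥ c.rep) • Z - (h ⬝ᵥ Z) • c.rep) := by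
    rw [hB, bil_smul, bil_join_section]
  have hX0 : bil B.rep X.rep X.rep = 0 := hX
  rw [hBv] at hX0
  have hQX := (mul_eq_zero.1 hX0).resolve_left hk
  have hD (Y : Fin 4 → ℂ) : h ⬝ᵥ ((h ⬝ᵥ c.rep) • Y - (h ⬝ᵥ Y) • c.rep) = 0 := by
    simp only [dotProduct_sub, dotProduct_smul, smul_eq_mul]
    ring
  -- If `c` lies in the plane of `β`, the cone is the double plane `h²`. Otherwise `DX` is the point
  -- where `c ∨ X` meets the plane of `β`, and `X ∈ B` says that it lies on `β`.
  by_cases hhc : h ⬝ᵥ c.rep = 0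
  · have hQc : bil Q c.rep c.rep ≠ 0 := fun h0 => hc ((hs.mem_curvePts c).2 ⟨hhc, h0⟩)
    have hBh (Y Z) : bil B.rep Y Z = k * bil Q c.rep c.rep * (h ⬝ᵥ Y) * (h ⬝ᵥ Z) := by
      rw [hBv, hhc]
      simp only [zero_smul, zero_sub, bil_neg_left, bil_neg_right, bil_smul_left, bil_smul_right]
      ring
    have hhX : h ⬝ᵥ X.rep = 0 := by
      have h1 := hBh X.rep X.rep
      rw [show bil B.rep X.rep X.rep = 0 from hX] at h1
      simpa [hk, hQc] using h1.symm
    constructor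
    · intro hXc
      obtain ⟨s, hs0⟩ := exists_bil_self_add_smul_eq_zero Q hQc X.rep
      have hne : X.rep + s • c.rep ≠ 0 := by
        intro h0
        refine hXc (eq_of_smul_rep (a := 1) (b := -s) one_ne_zero ?_)
        rw [one_smul, neg_smul]
        exact eq_neg_of_add_eq_zero_left h0
      obtain ⟨P, hP, a, ha, hPX⟩ := hs.exists_mem_curvePts hne
        (by simp [dotProduct_add, hhX, hhc]) hs0
      refine ⟨P, hP, ?_⟩
      rw [hPX, Submodule.mem_span_pair]
      exact ⟨a * s, a, by rw [smul_add, smul_smul, add_comm]⟩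
    · intro h3
      have hsing : B.rep.1 *ᵥ X.rep = 0 := eq_of_dotProduct fun Y => by
        rw [← bil_eq_dotProduct, hBh, hhX]
        simp
      have hT : tangentSpace B X = plane h := by
        refine (Submodule.eq_of_le_of_finrank_eq ?_ (by rw [h3, finrank_plane hs.ne_zero])).symm
        intro Z hZ
        refine mem_tangentSpace_of_singular hsing ?_
        rw [hBh, mem_plane.1 hZ, mul_zero]
      obtain ⟨P, hP⟩ := hs.curvePts_nonempty
      refine ⟨h3, P, hP, ?_, h, Q, hs, Or.inl ?_⟩
      · rw [hT, mem_plane]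
        exact ((hs.mem_curvePts P).1 hP).1
      · rw [hT]
        exact fun Y hY => mem_plane.2 hY.1
  · have hBc (Y) : bil B.rep c.rep Y = 0 := by
      rw [hBv]
      simp [bil_zero_left]
    have hBQ (Y Z) (hY : h ⬝ᵥ Y = 0) (hZ : h ⬝ᵥ Z = 0) :
        bil B.rep Y Z = k * (h ⬝ᵥ c.rep) ^ 2 * bil Q Y Z := by
      rw [hBv, hY, hZ]
      simp only [zero_smul, sub_zero, bil_smul_left, bil_smul_right]
      ring
    have hk2 : k * (h ⬝ᵥ c.rep) ^ 2 ≠ 0 := mul_ne_zero hk (pow_ne_zero 2 hhc)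
    have hDX : X ≠ c → (h ⬝ᵥ c.rep) • X.rep - (h ⬝ᵥ X.rep) • c.rep ≠ 0 := fun hXc h0 =>
      hXc (eq_of_smul_rep hhc (sub_eq_zero.1 h0))
    constructor
    · intro hXc
      obtain ⟨P, hP, a, ha, hPX⟩ := hs.exists_mem_curvePts (hDX hXc) (hD _) hQX
      refine ⟨P, hP, ?_⟩
      rw [hPX, Submodule.mem_span_pair]
      exact ⟨-(a * (h ⬝ᵥ X.rep)), a * (h ⬝ᵥ c.rep), by
        rw [smul_sub, smul_smul, smul_smul, neg_smul]; abel⟩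
    · intro h3
      by_cases hsing : B.rep.1 *ᵥ X.rep = 0
      -- A tangent plane at a singular point of the form makes `B` a double plane `t²`. Then `Q` is
      -- a multiple of `t²` on `h`, so `β` is a double line and any of its points is singular.
      · obtain ⟨t, -, hT, b, hb, hBt⟩ := exists_eq_sq_of_singular hsing h3
        obtain ⟨P, hP⟩ := hs.curvePts_nonempty
        obtain ⟨hP1, hP2⟩ := (hs.mem_curvePts P).1 hP
        have htP : t ⬝ᵥ P.rep = 0 := by
          have h1 := hBt P.rep P.rep
          rw [hBQ _ _ hP1 hP1, hP2, mul_zero] at h1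
          simpa [hb] using h1.symm
        refine ⟨h3, P, hP, by rw [hT]; exact mem_plane.2 htP, h, Q, hs, Or.inr ?_⟩
        rw [finrank_conicTangent_eq_three_iff hs.ne_zero]
        intro v hv
        have h1 := hBQ _ _ hP1 hv
        rw [hBt, htP, zero_mul, mul_zero] at h1
        exact (mul_eq_zero.1 h1.symm).resolve_left hk2
      · have hT := tangentSpace_eq_plane hsing h3
        have hXc : X ≠ c := by
          rintro rfl
          exact hsing (eq_of_dotProduct fun Y => by
            rw [← bil_eq_dotProduct, hBc, zero_dotProduct])
        obtain ⟨P, hP, a, ha, hPX⟩ := hs.exists_mem_curvePts (hDX hXc) (hD _) hQX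
        -- The tangent plane is constant along a ruling, so it may be computed at the point `P` of
        -- `β`.
        have hBP (Y) : bil B.rep P.rep Y = a * (h ⬝ᵥ c.rep) * bil B.rep X.rep Y := by
          rw [hPX]
          simp only [bil_smul_left, bil_sub_left, hBc]
          ring
        have hac : a * (h ⬝ᵥ c.rep) ≠ 0 := mul_ne_zero ha hhc
        have hmem (Y) (hY : bil B.rep P.rep Y = 0) : Y ∈ tangentSpace B X := by
          rw [hT, mem_plane, ← bil_eq_dotProduct]
          exact (mul_eq_zero.1 ((hBP Y).symm.trans hY)).resolve_left hac
        obtain ⟨hP1, hP2⟩ := (hs.mem_curvePts P).1 hP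
        refine ⟨h3, P, hP, hmem _ ?_, h, Q, hs, Or.inl fun Y hY => hmem _ ?_⟩
        · rw [hBQ _ _ hP1 hP1, hP2, mul_zero]
        · rw [hBQ _ _ hP1 hY.1, (mem_conicTangent.1 hY).2, mul_zero]

/-- If `c` is off the plane of `β`, then `β ⊆ B` puts the cone inside `B`, and the incidence
condition puts `B` inside the cone; equal zero sets give proportional forms. If `c` is in the plane,
incidence confines `B` to that plane, so `B` is a multiple of `h²`, as is the cone. -/
theorem mem_blowup_of_isAdapted_of_not_mem (hs : IsSection β h Q) (hc : c ∉ curvePts β) {B : P9}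
    (hBc : ∀ Y, bil B.rep c.rep Y = 0) (hA : IsAdapted c β B) : (β, B) ∈ blowup c := by
  have hsub := hs.curvePts_subset_iff.1 hA.1
  have meet (X : Fin 4 → ℂ) (hX : bil B.rep X X = 0) : (∃ s : ℂ, X = s • c.rep) ∨
      ∃ x y : ℂ, x • c.rep + y • X ≠ 0 ∧ h ⬝ᵥ (x • c.rep + y • X) = 0 ∧
        bil Q (x • c.rep + y • X) (x • c.rep + y • X) = 0 := by
    by_cases h0 : X = 0
    · exact Or.inl ⟨0, by rw [h0, zero_smul]⟩
    obtain ⟨x, a, ha, hx⟩ := exists_rep_eq_smul h0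
    by_cases hxc : x = c
    · exact Or.inl ⟨a⁻¹, by rw [← hxc, hx, smul_smul, inv_mul_cancel₀ ha, one_smul]⟩
    obtain ⟨P, hP, hPs⟩ := (hA.2 x (by
      change bil B.rep x.rep x.rep = 0
      rw [hx, bil_smul_left, bil_smul_right, hX, mul_zero, mul_zero])).1 hxc
    rw [Submodule.mem_span_pair, hx] at hPs
    obtain ⟨p, q, hpq⟩ := hPs
    rw [smul_smul] at hpq
    obtain ⟨hP1, hP2⟩ := (hs.mem_curvePts P).1 hP
    exact Or.inr ⟨p, q * a, by rw [hpq]; exact P.rep_nonzero, by rw [hpq]; exact hP1,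
      by rw [hpq]; exact hP2⟩
  rw [hs.mem_blowup_iff_of_not_mem hc]
  have hJ := hs.join_ne_zero hc
  by_cases hhc : h ⬝ᵥ c.rep = 0
  · have hQc : bil Q c.rep c.rep ≠ 0 := fun h0 => hc ((hs.mem_curvePts c).2 ⟨hhc, h0⟩)
    obtain ⟨k, hk, hB⟩ := eq_sq_of_zeros_subset (A := B.rep) hs.ne_zero fun X hX => by
      rcases meet X hX with ⟨s, rfl⟩ | ⟨x, y, hne, h1, h2⟩
      · simp [hhc]
      · have hy : y ≠ 0 := by
          rintro rfl
          have hx : x ≠ 0 := by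
            rintro rfl
            simp at hne
          simp only [zero_smul, add_zero, bil_smul_left, bil_smul_right] at h2
          simp [hx, hQc] at h2
        simpa [dotProduct_add, hhc, hy] using h1
    refine ⟨k / bil Q c.rep c.rep, div_ne_zero hk hQc, ext_of_bil fun X Y => ?_⟩
    rw [hB, bil_smul, bil_join_section, hhc]
    simp only [zero_smul, zero_sub, bil_neg_left, bil_neg_right, bil_smul_left, bil_smul_right]
    field_simp
  · refine eq_smul_of_same_zeros hJ fun X => ?_
    rw [bil_join_section]
    have hBD : bil B.rep ((h ⬝ᵥ c.rep) • X - (h ⬝ᵥ X) • c.rep)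
        ((h ⬝ᵥ c.rep) • X - (h ⬝ᵥ X) • c.rep) = (h ⬝ᵥ c.rep) ^ 2 * bil B.rep X X := by
      simp only [bil_sub_left, bil_sub_right, bil_smul_left, bil_smul_right, hBc,
        bil_comm B.rep X c.rep]
      ring
    constructor
    · intro hX
      have h1 := hsub _ (by simp only [dotProduct_sub, dotProduct_smul, smul_eq_mul]; ring) hX
      rw [hBD] at h1
      exact (mul_eq_zero.1 h1).resolve_left (pow_ne_zero 2 hhc)
    · intro hX
      rcases meet X hX with ⟨s, rfl⟩ | ⟨x, y, hne, h1, h2⟩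
      · have : (h ⬝ᵥ c.rep) • s • c.rep - (h ⬝ᵥ s • c.rep) • c.rep = 0 := by
          rw [dotProduct_smul, smul_smul, smul_eq_mul, mul_comm, sub_self]
        rw [this, bil_zero_left]
      · have e : (h ⬝ᵥ c.rep) • (x • c.rep + y • X) =
            y • ((h ⬝ᵥ c.rep) • X - (h ⬝ᵥ X) • c.rep) := by
          rw [dotProduct_add, dotProduct_smul, dotProduct_smul, smul_eq_mul, smul_eq_mul] at h1
          ext i
          simp only [Pi.smul_apply, Pi.add_apply, Pi.sub_apply, smul_eq_mul]
          linear_combination c.rep i * h1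
        have hy : y ≠ 0 := by
          rintro rfl
          exact smul_ne_zero hhc hne (e.trans (zero_smul _ _))
        have h3 : (h ⬝ᵥ c.rep) * ((h ⬝ᵥ c.rep) * bil Q (x • c.rep + y • X) (x • c.rep + y • X)) =
            0 := by rw [h2, mul_zero, mul_zero]
        rw [← bil_smul_right, ← bil_smul_left, e, bil_smul_left, bil_smul_right] at h3
        simpa [hy] using h3

end Miss

/-! ### Conics through the vertex -/

section Through

variable {c : P3} {β : P20} {h : Fin 4 → ℂ} {Q : symMat 4}

theorem IsSection.curvePts_subset_curvePts {h' : Fin 4 → ℂ} {Q' : symMat 4}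
    (hs : IsSection β h Q) (hs' : IsSection β h' Q') {P : Fin 4 → ℂ} (h1 : h ⬝ᵥ P = 0)
    (h2 : bil Q P P = 0) : h' ⬝ᵥ P = 0 ∧ bil Q' P P = 0 := by
  by_cases hP : P = 0
  · rw [hP, dotProduct_zero, bil_zero_left]
    exact ⟨rfl, rfl⟩
  obtain ⟨X, hX, a, ha, hXP⟩ := hs.exists_mem_curvePts hP h1 h2
  obtain ⟨h3, h4⟩ := (hs'.mem_curvePts X).1 hX
  rw [hXP, dotProduct_smul, smul_eq_mul] at h3
  rw [hXP, bil_smul_left, bil_smul_right] at h4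
  exact ⟨by simpa [ha] using h3, by simpa [ha] using h4⟩

/-- A conic is a pair of lines meeting at `c` exactly when it is singular at `c`. -/
theorem IsSection.isLinePairAt_iff (hs : IsSection β h Q) (hc : c ∈ curvePts β) :
    IsLinePairAt β c ↔ ∀ v, h ⬝ᵥ v = 0 → bil Q c.rep v = 0 := by
  obtain ⟨hhc, hQc⟩ := (hs.mem_curvePts c).1 hc
  constructor
  · rintro ⟨L₁, L₂, -, -, hc1, hc2, hL⟩ v hv
    by_contra hne
    -- The second intersection of the line `c ∨ v` with `β`. One of the two lines contains `c` and
    -- `w`, hence also their sums, but `Q(c, w) ≠ 0` keeps those off `β`.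
    set w := v - (bil Q v v / (2 * bil Q c.rep v)) • c.rep with hw
    have hQw : bil Q w w = 0 := by
      simp only [hw, bil_sub_left, bil_sub_right, bil_smul_left, bil_smul_right, hQc,
        bil_comm Q v c.rep]
      field_simp
      ring
    have hQcw : bil Q c.rep w = bil Q c.rep v := by
      rw [hw, bil_sub_right, bil_smul_right, hQc, mul_zero, sub_zero]
    have hhw : h ⬝ᵥ w = 0 := by simp [hw, dotProduct_sub, hv, hhc]
    have hw0 : w ≠ 0 := by
      intro h0
      rw [h0, bil_zero_right] at hQcw
      exact hne hQcw.symm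
    obtain ⟨W, hW, a, ha, hWw⟩ := hs.exists_mem_curvePts hw0 hhw hQw
    have hsum : c.rep + W.rep ≠ 0 := by
      intro h0
      have : bil Q c.rep (c.rep + W.rep) = 0 := by rw [h0, bil_zero_right]
      rw [bil_add_right, hQc, hWw, bil_smul_right, hQcw, zero_add] at this
      exact mul_ne_zero ha hne this
    obtain ⟨Z, b, hb, hZ⟩ := exists_rep_eq_smul hsum
    have hZm : Z ∈ curvePts β := by
      rw [hL, hZ]
      rcases (hL W).1 hW with h1 | h1
      · exact Or.inl (L₁.smul_mem _ (L₁.add_mem hc1 h1))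
      · exact Or.inr (L₂.smul_mem _ (L₂.add_mem hc2 h1))
    have hZQ := ((hs.mem_curvePts Z).1 hZm).2
    rw [hZ, hWw] at hZQ
    simp only [bil_add_left, bil_add_right, bil_smul_left, bil_smul_right, hQc, hQw, hQcw,
      bil_comm Q w c.rep] at hZQ
    have : b ^ 2 * (2 * (a * bil Q c.rep v)) = 0 := by linear_combination hZQ
    simp [hb, ha, hne] at this
  · intro hsing
    -- In coordinates `x c + y v + z e` the form is `y (y Q(v, v) + 2 z Q(v, e))`; its two factors
    -- are the lines, which coincide when `Q(v, e) = 0`.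
    obtain ⟨v, e, hv, he, hQv, hQe, hind, hspan⟩ :=
      exists_isotropic_frame hs.1 c.rep_nonzero hhc hQc
    have hQX (x y z : ℂ) : bil Q (x • c.rep + y • v + z • e) (x • c.rep + y • v + z • e) =
        y * (y * bil Q v v + 2 * z * bil Q v e) := by
      simp only [bil_add_left, bil_add_right, bil_smul_left, bil_smul_right, hQc, hsing v hv,
        hsing e he, hQe, bil_comm Q v c.rep, bil_comm Q e c.rep, bil_comm Q e v]
      ring
    have hc1 {e : Fin 4 → ℂ} : c.rep ∈ Submodule.span ℂ {c.rep, e} :=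
      Submodule.subset_span (by simp)
    refine ⟨Submodule.span ℂ {c.rep, e},
      Submodule.span ℂ {c.rep, (2 * bil Q v e) • v - bil Q v v • e},
      finrank_span_pair_eq_two c.rep_nonzero fun s hse => hind s 0 (by
        rw [hse, zero_smul, add_zero]),
      finrank_span_pair_eq_two c.rep_nonzero fun s hse => ?_, hc1, hc1, fun X => ?_⟩
    · refine hind (-s / bil Q v v) (2 * bil Q v e / bil Q v v) ?_
      ext i
      have hi := congrFun hse i
      simp only [Pi.smul_apply, Pi.add_apply, Pi.sub_apply, smul_eq_mul] at hi ⊢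
      field_simp
      linear_combination -hi
    · rw [hs.mem_curvePts, Submodule.mem_span_pair, Submodule.mem_span_pair]
      constructor
      · rintro ⟨h1, h2⟩
        obtain ⟨x, y, z, hX⟩ := hspan _ h1
        rw [hX, hQX] at h2
        rcases mul_eq_zero.1 h2 with hy | hy
        · exact Or.inl ⟨x, z, by rw [hX, hy, zero_smul, add_zero]⟩
        · refine Or.inr ⟨x, -z / bil Q v v, ?_⟩
          rw [hX]
          ext i
          simp only [Pi.smul_apply, Pi.add_apply, Pi.sub_apply, smul_eq_mul]
          field_simp
          linear_combination -v i * hy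
      · rintro (⟨x, z, hX⟩ | ⟨x, z, hX⟩)
        · have hX' : X.rep = x • c.rep + (0 : ℂ) • v + z • e := by
            rw [← hX, zero_smul, add_zero]
          rw [hX', hQX, zero_mul]
          exact ⟨by simp [dotProduct_add, hhc, he], rfl⟩
        · have hX' : X.rep = x • c.rep + (z * (2 * bil Q v e)) • v + (-(z * bil Q v v)) • e := by
            rw [← hX, smul_sub, smul_smul, smul_smul, neg_smul]
            abel
          rw [hX', hQX]
          exact ⟨by simp [dotProduct_add, hhc, hv, he], by ring⟩

theorem mem_curvePts_of_isLinePairAt (hL : IsLinePairAt β c) : c ∈ curvePts β := by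
  obtain ⟨L₁, L₂, -, -, hc1, -, h⟩ := hL
  exact (h c).2 (Or.inl hc1)

theorem mem_blowup_iff_of_isLinePairAt (hs : IsSection β h Q) (hL : IsLinePairAt β c) (B : P9) :
    (β, B) ∈ blowup c ↔ B ∈ cones c ∧ curvePts β ⊆ quadricPts B := by
  have hc := mem_curvePts_of_isLinePairAt hL
  refine ⟨fun hm => ⟨hm.1.2, curvePts_subset_of_mem_blowup hm⟩, fun ⟨hB, hsub⟩ => ?_⟩
  rw [hs.mem_blowup_iff]
  rw [mem_cones_iff] at hB
  exact ⟨hB, inClosure_of_linePair hs.1 ((hs.mem_curvePts c).1 hc).1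
    ((hs.isLinePairAt_iff hc).1 hL) hB B.rep_nonzero (hs.curvePts_subset_iff.1 hsub)⟩

/-- Projection from a smooth point `c` of the conic maps the conic densely to its plane. -/
theorem exists_isotropic_add_smul (hQc : bil Q c.rep c.rep = 0) {X : Fin 4 → ℂ}
    (hX : bil Q c.rep X ≠ 0) : ∃ s : ℂ, bil Q (X + s • c.rep) (X + s • c.rep) = 0 := by
  refine ⟨-(bil Q X X / (2 * bil Q c.rep X)), ?_⟩
  simp only [bil_add_left, bil_add_right, bil_smul_left, bil_smul_right, hQc, bil_comm Q X c.rep]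
  field_simp
  ring

/-- Every line through `c` in the plane, other than the tangent, meets `β` in a second point, so the
cone `B` contains it. For `X` on the tangent, the parallelogram law for `X ± v` concludes. -/
theorem bil_self_eq_zero_of_smooth {B : symMat 4} {v : Fin 4 → ℂ} (hhc : h ⬝ᵥ c.rep = 0)
    (hQc : bil Q c.rep c.rep = 0) (hv : h ⬝ᵥ v = 0) (hQv : bil Q c.rep v ≠ 0)
    (hBc : ∀ Y, bil B c.rep Y = 0)
    (hsub : ∀ P, h ⬝ᵥ P = 0 → bil Q P P = 0 → bil B P P = 0) {X : Fin 4 → ℂ} (hX : h ⬝ᵥ X = 0) :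
    bil B X X = 0 := by
  have main (Y : Fin 4 → ℂ) (hY : h ⬝ᵥ Y = 0) (hQY : bil Q c.rep Y ≠ 0) : bil B Y Y = 0 := by
    obtain ⟨s, hs⟩ := exists_isotropic_add_smul hQc hQY
    have := hsub _ (by simp [dotProduct_add, hY, hhc]) hs
    simpa [bil_add_left, bil_add_right, bil_smul_left, bil_smul_right, hBc,
      bil_comm B Y c.rep] using this
  by_cases hQX : bil Q c.rep X = 0
  · have h1 := main (X + v) (by simp [dotProduct_add, hX, hv]) (by
      rwa [bil_add_right, hQX, zero_add])
    have h2 := main (X - v) (by simp [dotProduct_sub, hX, hv]) (by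
      rw [bil_sub_right, hQX, zero_sub]
      exact neg_ne_zero.2 hQv)
    have h3 := main v hv hQv
    simp only [bil_add_left, bil_add_right, bil_sub_left, bil_sub_right, h3] at h1 h2
    linear_combination (h1 + h2) / 2
  · exact main X hX hQX

/-- Apply the hypothesis to `X - (h ⬝ X) w` with `h ⬝ w = 1` and solve for `B(X, X)`: a factor `h ⬝
X` splits off. -/
theorem exists_eq_symProd {B : symMat 4} (hh : h ≠ 0)
    (hB : ∀ X, h ⬝ᵥ X = 0 → bil B X X = 0) : ∃ m, B = symProd h m := by
  obtain ⟨w, hw⟩ := exists_dotProduct_eq_one hh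
  refine ⟨B.1 *ᵥ w - (bil B w w / 2) • h, ext_of_qval fun X => ?_⟩
  have h1 := hB (X - (h ⬝ᵥ X) • w) (by simp [dotProduct_sub, hw])
  simp only [bil_sub_left, bil_sub_right, bil_smul_left, bil_smul_right, bil_comm B X w] at h1
  rw [bil_symProd, sub_dotProduct, ← bil_eq_dotProduct, smul_dotProduct, smul_eq_mul]
  linear_combination h1

theorem symProd_smul (h m : Fin 4 → ℂ) (k : ℂ) : symProd h (k • m) = k • symProd h m :=
  ext_of_bil fun X Y => by
    simp only [bil_smul, bil_symProd, smul_dotProduct, smul_eq_mul]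
    ring

theorem curveSpan_eq_plane (hs : IsSection β h Q) (hc : c ∈ curvePts β) {v : Fin 4 → ℂ}
    (hv : h ⬝ᵥ v = 0) (hQv : bil Q c.rep v ≠ 0) : curveSpan β = plane h := by
  obtain ⟨hhc, hQc⟩ := (hs.mem_curvePts c).1 hc
  have mem (P : Fin 4 → ℂ) (h1 : h ⬝ᵥ P = 0) (h2 : bil Q P P = 0) : P ∈ curveSpan β := by
    by_cases hP : P = 0
    · rw [hP]
      exact Submodule.zero_mem _
    obtain ⟨X, hX, a, ha, hXP⟩ := hs.exists_mem_curvePts hP h1 h2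
    have h3 : X.rep ∈ curveSpan β := Submodule.subset_span ⟨X, hX, rfl⟩
    rw [hXP] at h3
    exact (Submodule.smul_mem_iff _ ha).1 h3
  have main (Y : Fin 4 → ℂ) (hY : h ⬝ᵥ Y = 0) (hQY : bil Q c.rep Y ≠ 0) : Y ∈ curveSpan β := by
    obtain ⟨s, hs⟩ := exists_isotropic_add_smul hQc hQY
    have h1 := mem _ (by simp [dotProduct_add, hY, hhc]) hs
    exact (Submodule.add_mem_iff_left _ (Submodule.smul_mem _ s (mem _ hhc hQc))).1 h1
  apply le_antisymm
  · refine Submodule.span_le.2 ?_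
    rintro _ ⟨X, hX, rfl⟩
    exact mem_plane.2 ((hs.mem_curvePts X).1 hX).1
  · intro X hX
    rw [mem_plane] at hX
    by_cases hQX : bil Q c.rep X = 0
    · exact (Submodule.add_mem_iff_left _ (main v hv hQv)).1 (main (X + v)
        (by simp [dotProduct_add, hX, hv]) (by rwa [bil_add_right, hQX, zero_add]))
    · exact main X hX hQX

/-- The tangent line at a smooth point does not depend on the presentation. The plane is the span of
`β`. If a line tangent for `Q` were not tangent for `Q'`, it would meet `β` in a second point and
so, by tangency for `Q`, lie in `β`; but for `Q'` it does not. -/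
theorem conicTangent_le {h' v' : Fin 4 → ℂ} {Q' : symMat 4} (hs : IsSection β h Q)
    (hs' : IsSection β h' Q') (hc : c ∈ curvePts β) {v : Fin 4 → ℂ}
    (hv : h ⬝ᵥ v = 0) (hQv : bil Q c.rep v ≠ 0) (hv' : h' ⬝ᵥ v' = 0)
    (hQv' : bil Q' c.rep v' ≠ 0) : conicTangent h Q c.rep ≤ conicTangent h' Q' c.rep := by
  rintro Y ⟨hY, hQY⟩
  change bil Q c.rep Y = 0 at hQY
  obtain ⟨hhc, hQc⟩ := (hs.mem_curvePts c).1 hc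
  obtain ⟨hhc', hQc'⟩ := (hs'.mem_curvePts c).1 hc
  have hplane : plane h = plane h' := by
    rw [← curveSpan_eq_plane hs hc hv hQv, curveSpan_eq_plane hs' hc hv' hQv']
  have hY' : h' ⬝ᵥ Y = 0 := by
    rw [← mem_plane, ← hplane]
    exact mem_plane.2 hY
  refine mem_conicTangent.2 ⟨hY', ?_⟩
  by_contra hne
  obtain ⟨s, hs0⟩ := exists_isotropic_add_smul hQc' hne
  have h1 := (hs'.curvePts_subset_curvePts hs (by simp [dotProduct_add, hY', hhc']) hs0).2
  have h2 : bil Q c.rep (Y + s • c.rep) = 0 := by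
    rw [bil_add_right, bil_smul_right, hQY, hQc, mul_zero, add_zero]
  have h2' : bil Q' c.rep (Y + s • c.rep) = bil Q' c.rep Y := by
    rw [bil_add_right, bil_smul_right, hQc', mul_zero, add_zero]
  have hhw : h ⬝ᵥ (Y + s • c.rep) = 0 := by simp [dotProduct_add, hY, hhc]
  generalize Y + s • c.rep = w at hs0 h1 h2 h2' hhw
  have h3 := (hs.curvePts_subset_curvePts hs' (P := w + c.rep)
    (by rw [dotProduct_add, hhw, hhc, add_zero])
    (by simp only [bil_add_left, bil_add_right, bil_comm Q w c.rep, h1, h2, hQc, add_zero])).2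
  simp only [bil_add_left, bil_add_right, bil_comm Q' w c.rep, hs0, h2', hQc'] at h3
  have h4 : 2 * bil Q' c.rep Y = 0 := by linear_combination h3
  simp [hne] at h4

theorem isTangentLine_iff (hs : IsSection β h Q) (hc : c ∈ curvePts β) {v : Fin 4 → ℂ}
    (hv : h ⬝ᵥ v = 0) (hQv : bil Q c.rep v ≠ 0) (ℓ : Submodule ℂ (Fin 4 → ℂ)) :
    IsTangentLine β c ℓ ↔ ℓ = conicTangent h Q c.rep := by
  constructor
  · rintro ⟨-, h2, h', Q', hs', rfl⟩
    obtain ⟨v', hv', hQv'⟩ : ∃ v', h' ⬝ᵥ v' = 0 ∧ bil Q' c.rep v' ≠ 0 := by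
      by_contra! hall
      rw [(finrank_conicTangent_eq_three_iff hs'.ne_zero).2 hall] at h2
      norm_num at h2
    exact le_antisymm (conicTangent_le hs' hs hc hv' hQv' hv hQv)
      (conicTangent_le hs hs' hc hv hQv hv' hQv')
  · rintro rfl
    exact ⟨hc, finrank_conicTangent_eq_two hs.ne_zero hv hQv, h, Q, hs, rfl⟩

theorem mem_blowup_iff_of_smooth (hs : IsSection β h Q) (hc : c ∈ curvePts β) {v : Fin 4 → ℂ}
    (hv : h ⬝ᵥ v = 0) (hQv : bil Q c.rep v ≠ 0) (B : P9) : (β, B) ∈ blowup c ↔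
      ∃ m, B.rep = symProd h m ∧ conicTangent h Q c.rep ≤ plane m := by
  obtain ⟨hhc, hQc⟩ := (hs.mem_curvePts c).1 hc
  rw [hs.mem_blowup_iff]
  constructor
  · rintro ⟨hBc, hcl⟩
    have hsub (P : Fin 4 → ℂ) (h1 : h ⬝ᵥ P = 0) (h2 : bil Q P P = 0) :=
      hcl.bil_self_eq_zero hs.1 h1 h2
    obtain ⟨m, hm⟩ := exists_eq_symProd hs.ne_zero fun X hX =>
      bil_self_eq_zero_of_smooth hhc hQc hv hQv hBc hsub hX
    refine ⟨m, hm, ?_⟩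
    rintro Y ⟨hY, hQY⟩
    change bil Q c.rep Y = 0 at hQY
    obtain ⟨w, hw⟩ := exists_dotProduct_eq_one hs.ne_zero
    -- With `h ⬝ w = 1`, `h ⬝ v = 0` and `Y` on the tangent line, the wedge equation collapses to
    -- `(m ⬝ Y) Q(c, v) = 0`.
    have h1 := hcl.wedge_eq_zero w Y v w
    rw [hm] at h1
    simp only [bil_section, bil_symProd, hhc, hw, hv, hY, zero_smul, one_smul, zero_sub, sub_zero,
      bil_neg_left, bil_neg_right, bil_zero_right, hQY, sub_self] at h1
    rw [mem_plane]
    simpa [hQv] using h1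
  · rintro ⟨m, hm, hle⟩
    obtain ⟨a, b, hab⟩ := exists_eq_smul_add_smul_of_dotProduct (q := Q.1 *ᵥ c.rep) (m := m)
      hs.ne_zero hv (by rwa [← bil_eq_dotProduct]) fun Y h1 h2 =>
        mem_plane.1 (hle (mem_conicTangent.2 ⟨h1, by rwa [bil_eq_dotProduct]⟩))
    have hmc : m ⬝ᵥ c.rep = 0 := mem_plane.1 (hle (mem_conicTangent.2 ⟨hhc, hQc⟩))
    have hB : B.rep = a • symProd h h + b • symProd h (Q.1 *ᵥ c.rep) := by
      rw [hm, hab]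
      refine ext_of_bil fun X Y => ?_
      simp only [bil_add, bil_smul, bil_symProd, add_dotProduct, smul_dotProduct, smul_eq_mul]
      ring
    refine ⟨fun Y => by rw [hm, bil_symProd, hhc, hmc]; ring, ?_⟩
    have hne := B.rep_nonzero
    rw [hB] at hne ⊢
    exact inClosure_of_smooth hhc hQc a b hne

theorem mem_blowup_iff_exists_plane (hs : IsSection β h Q) (hc : c ∈ curvePts β) {v : Fin 4 → ℂ}
    (hv : h ⬝ᵥ v = 0) (hQv : bil Q c.rep v ≠ 0) (B : P9) : (β, B) ∈ blowup c ↔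
      ∃ H : Submodule ℂ (Fin 4 → ℂ), Module.finrank ℂ H = 3 ∧ conicTangent h Q c.rep ≤ H ∧
        ∀ X : P3, X ∈ quadricPts B ↔ X.rep ∈ curveSpan β ∨ X.rep ∈ H := by
  rw [mem_blowup_iff_of_smooth hs hc hv hQv, curveSpan_eq_plane hs hc hv hQv]
  have hprod (m X : Fin 4 → ℂ) : bil (symProd h m) X X = 0 ↔ h ⬝ᵥ X = 0 ∨ m ⬝ᵥ X = 0 := by
    rw [bil_symProd, mul_comm (m ⬝ᵥ X), ← two_mul]
    simp
  constructor
  · rintro ⟨m, hm, hle⟩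
    have hm0 : m ≠ 0 := by
      rintro rfl
      refine B.rep_nonzero (hm.trans (ext_of_bil fun X Y => ?_))
      rw [bil_symProd]
      simp [bil]
    refine ⟨plane m, finrank_plane hm0, hle, fun X => ?_⟩
    rw [mem_plane, mem_plane, ← hprod, ← hm]
    rfl
  · rintro ⟨H, hH, hle, hB⟩
    obtain ⟨m, hm, rfl⟩ := exists_eq_plane hH
    obtain ⟨k, hk, hBk⟩ := eq_smul_of_same_zeros (A := B.rep) (A' := symProd h m) B.rep_nonzero
      fun X => by
        rw [hprod]
        by_cases hX : X = 0
        · simp [hX, bil_zero_left]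
        obtain ⟨P, a, ha, hP⟩ := exists_rep_eq_smul hX
        have h1 := hB P
        change bil B.rep P.rep P.rep = 0 ↔ _ at h1
        rw [mem_plane, mem_plane, hP] at h1
        simpa [bil_smul_left, bil_smul_right, ha] using h1
    refine ⟨k⁻¹ • m, ?_, fun Y hY => ?_⟩
    · rw [symProd_smul, hBk, smul_smul, inv_mul_cancel₀ hk, one_smul]
    · rw [mem_plane, smul_dotProduct, mem_plane.1 (hle hY), smul_zero]

/-- The point `c` serves throughout: it lies on `β`, on every line `c ∨ X` and in every tangent
plane of the cone. If `β` is smooth at `c`, its tangent line lies in both planes of `B`, so it lies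
in every tangent space of `B`. -/
theorem isAdapted_of_mem_blowup_of_mem (hs : IsSection β h Q) (hc : c ∈ curvePts β) {B : P9}
    (hm : (β, B) ∈ blowup c) : IsAdapted c β B := by
  refine ⟨curvePts_subset_of_mem_blowup hm, fun X hX => ⟨fun _ =>
    ⟨c, hc, Submodule.subset_span (by simp)⟩, fun h3 => ?_⟩⟩
  have hBc := ((hs.mem_blowup_iff c B).1 hm).1
  refine ⟨h3, c, hc, vertex_mem_tangentSpace hBc hX, h, Q, hs, ?_⟩
  by_cases hsing : ∀ v, h ⬝ᵥ v = 0 → bil Q c.rep v = 0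
  · exact Or.inr ((finrank_conicTangent_eq_three_iff hs.ne_zero).2 hsing)
  · push Not at hsing
    obtain ⟨v, hv, hQv⟩ := hsing
    obtain ⟨m, hBm, hle⟩ := (mem_blowup_iff_of_smooth hs hc hv hQv B).1 hm
    refine Or.inl fun Y hY => mem_tangentSpace_of_line fun t => ?_
    have hX0 : bil B.rep X.rep X.rep = 0 := hX
    have hY0 (Z) : bil B.rep Z Y = 0 := by
      rw [hBm, bil_symProd, hY.1, mem_plane.1 (hle hY)]
      ring
    simp [bil_add_left, bil_add_right, bil_smul_left, bil_smul_right, hX0, hY0,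
      bil_comm B.rep Y X.rep]

theorem mem_blowup_of_isAdapted_of_smooth (hs : IsSection β h Q) (hc : c ∈ curvePts β)
    {v : Fin 4 → ℂ} (hv : h ⬝ᵥ v = 0) (hQv : bil Q c.rep v ≠ 0) {B : P9}
    (hBc : ∀ Y, bil B.rep c.rep Y = 0) (hA : IsAdapted c β B) : (β, B) ∈ blowup c := by
  obtain ⟨hhc, hQc⟩ := (hs.mem_curvePts c).1 hc
  obtain ⟨m, hm⟩ := exists_eq_symProd hs.ne_zero fun X hX =>
    bil_self_eq_zero_of_smooth hhc hQc hv hQv hBc (hs.curvePts_subset_iff.1 hA.1) hX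
  refine (mem_blowup_iff_of_smooth hs hc hv hQv B).2 ⟨m, hm, ?_⟩
  have hBv (Y Z) : bil B.rep Y Z = (h ⬝ᵥ Y) * (m ⬝ᵥ Z) + (m ⬝ᵥ Y) * (h ⬝ᵥ Z) := by
    rw [hm, bil_symProd]
  have hm0 : m ≠ 0 := by
    rintro rfl
    refine B.rep_nonzero (ext_of_bil fun X Y => ?_)
    rw [hBv]
    simp [bil]
  have hmc : m ⬝ᵥ c.rep = 0 := by
    obtain ⟨w, hw⟩ := exists_dotProduct_eq_one hs.ne_zero
    have := hBc w
    rwa [hBv, hhc, hw, zero_mul, mul_one, zero_add] at this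
  by_cases hX : ∀ X, m ⬝ᵥ X = 0 → h ⬝ᵥ X = 0
  · obtain ⟨k, rfl⟩ := exists_eq_smul_of_dotProduct hm0 hX
    have hk : k ≠ 0 := by
      rintro rfl
      exact hs.ne_zero (zero_smul _ _)
    intro Y hY
    have := hY.1
    rw [smul_dotProduct, smul_eq_mul] at this
    exact mem_plane.2 ((mul_eq_zero.1 this).resolve_left hk)
  push Not at hX
  -- A point of the plane `m` off `h` is a smooth point of `B`, with tangent plane `m`; so `m` is a
  -- tangent plane of `β`, at some `P`.
  obtain ⟨X, hmX, hhX⟩ := hX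
  obtain ⟨x, a, ha, hx⟩ := exists_rep_eq_smul (v := X) (by
    rintro rfl
    simp at hhX)
  have hmx : m ⬝ᵥ x.rep = 0 := by rw [hx, dotProduct_smul, hmX, smul_zero]
  have hhx : h ⬝ᵥ x.rep ≠ 0 := by
    rw [hx, dotProduct_smul]
    exact smul_ne_zero ha hhX
  have hT : tangentSpace B x = plane m := by
    ext Y
    rw [mem_plane]
    constructor
    · intro hY
      have h1 := bil_eq_zero_of_mem_tangentSpace hY
      rw [hBv, hmx] at h1
      simpa [hhx] using h1
    · intro hY
      refine mem_tangentSpace_of_line fun t => ?_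
      rw [hBv, dotProduct_add, dotProduct_smul, dotProduct_add, dotProduct_smul, hY, hmx]
      simp
  have hxB : x ∈ quadricPts B := by
    change bil B.rep x.rep x.rep = 0
    rw [hBv, hmx]
    ring
  have hTP := (hA.2 x hxB).2 (by rw [hT, finrank_plane hm0])
  rw [hT] at hTP
  obtain ⟨-, P, hP, hPm, h', Q', hs', hcases⟩ := hTP
  rw [mem_plane] at hPm
  obtain ⟨hhc', hQc'⟩ := (hs'.mem_curvePts c).1 hc
  obtain ⟨hhP', hQP'⟩ := (hs'.mem_curvePts P).1 hP
  have hnL : ¬ IsLinePairAt β c := fun hL => hQv ((hs.isLinePairAt_iff hc).1 hL v hv)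
  rw [hs'.isLinePairAt_iff hc] at hnL
  push Not at hnL
  obtain ⟨v', hv', hQv'⟩ := hnL
  refine (conicTangent_le hs hs' hc hv hQv hv' hQv').trans ?_
  rw [finrank_conicTangent_eq_three_iff hs'.ne_zero] at hcases
  by_cases hPc : P = c
  · subst hPc
    exact hcases.resolve_right fun h3 => hQv' (h3 v' hv')
  by_cases hQcP : bil Q' c.rep P.rep = 0
  -- `P` is a second point on the tangent line at `c`, which is therefore `c ∨ P` and lies in `m`.
  · have hcP (s : ℂ) : P.rep ≠ s • c.rep := fun he =>
      hPc (eq_of_smul_rep (a := 1) (b := s) one_ne_zero (by rw [one_smul, he]))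
    have hle : Submodule.span ℂ {c.rep, P.rep} ≤ conicTangent h' Q' c.rep := by
      rw [Submodule.span_le]
      rintro _ (rfl | rfl)
      · exact mem_conicTangent.2 ⟨hhc', hQc'⟩
      · exact mem_conicTangent.2 ⟨hhP', hQcP⟩
    rw [← Submodule.eq_of_le_of_finrank_eq hle (by
      rw [finrank_span_pair_eq_two c.rep_nonzero hcP,
        finrank_conicTangent_eq_two hs'.ne_zero hv' hQv']), Submodule.span_le]
    rintro _ (rfl | rfl)
    · exact mem_plane.2 hmc
    · exact mem_plane.2 hPm
  · rw [bil_comm] at hQcP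
    have hle := hcases.resolve_right fun h3 => hQcP (h3 _ hhc')
    -- `P` is smooth and its tangent line misses `c`, so that line and `c` span the whole plane of
    -- `β`. Explicitly, `Y` is corrected by a multiple of `c` to be tangent at `P`.
    intro Y hY
    have hmem : bil Q' P.rep c.rep • Y - bil Q' P.rep Y • c.rep ∈ conicTangent h' Q' P.rep :=
      mem_conicTangent.2 ⟨by simp [dotProduct_sub, hY.1, hhc'], by
        rw [bil_sub_right, bil_smul_right, bil_smul_right]
        ring⟩
    have h1 := mem_plane.1 (hle hmem)
    rw [dotProduct_sub, dotProduct_smul, dotProduct_smul, hmc, smul_zero, sub_zero,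
      smul_eq_mul] at h1
    exact mem_plane.2 ((mul_eq_zero.1 h1).resolve_left hQcP)

end Through

/-! ### Assembly of the cases -/

theorem mem_blowup_iff_isAdapted {c : P3} {β : P20} {B : P9} :
    (β, B) ∈ blowup c ↔ β ∈ chPlane ∧ B ∈ cones c ∧ IsAdapted c β B := by
  constructor
  · intro hm
    obtain ⟨h, Q, hs⟩ := hm.1.1
    refine ⟨hm.1.1, hm.1.2, ?_⟩
    by_cases hc : c ∈ curvePts β
    · exact isAdapted_of_mem_blowup_of_mem hs hc hm
    · exact isAdapted_of_mem_blowup_of_not_mem hs hc hm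
  · rintro ⟨⟨h, Q, hs⟩, hB, hA⟩
    have hBc := mem_cones_iff.1 hB
    by_cases hc : c ∈ curvePts β
    · by_cases hL : IsLinePairAt β c
      · exact (mem_blowup_iff_of_isLinePairAt hs hL B).2 ⟨hB, hA.1⟩
      · rw [hs.isLinePairAt_iff hc] at hL
        push Not at hL
        obtain ⟨v, hv, hQv⟩ := hL
        exact mem_blowup_of_isAdapted_of_smooth hs hc hv hQv hBc hA
    · exact mem_blowup_of_isAdapted_of_not_mem hs hc hBc hA

end ConicCone

theorem lemma3p2 (c : P3) :
    -- the description of the closure of the graph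
    blowup c = {p : P20 × P9 | p.1 ∈ chPlane ∧ p.2 ∈ cones c ∧
      curvePts p.1 ⊆ quadricPts p.2 ∧
      ∀ X ∈ quadricPts p.2,
        (X ≠ c → ∃ P ∈ curvePts p.1, P.rep ∈ Submodule.span ℂ {c.rep, X.rep}) ∧
        (Module.finrank ℂ (tangentSpace p.2 X) = 3 →
          IsTangentPlane p.1 (tangentSpace p.2 X))} ∧
    -- the three cases
    ∀ β ∈ chPlane,
      (c ∉ curvePts β →
        ∃ B₀ : P9, IsJoin c β B₀ ∧ ∀ B : P9, (β, B) ∈ blowup c ↔ B = B₀) ∧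
      (c ∈ curvePts β → ¬ IsLinePairAt β c →
        Module.finrank ℂ (curveSpan β) = 3 ∧
        ∃ ℓ : Submodule ℂ (Fin 4 → ℂ),
          (∀ ℓ' : Submodule ℂ (Fin 4 → ℂ), IsTangentLine β c ℓ' ↔ ℓ' = ℓ) ∧
          ∀ B : P9, (β, B) ∈ blowup c ↔
            ∃ H : Submodule ℂ (Fin 4 → ℂ), Module.finrank ℂ H = 3 ∧ ℓ ≤ H ∧
              ∀ X : P3, X ∈ quadricPts B ↔ X.rep ∈ curveSpan β ∨ X.rep ∈ H) ∧
      (IsLinePairAt β c →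
        ∀ B : P9, (β, B) ∈ blowup c ↔ B ∈ cones c ∧ curvePts β ⊆ quadricPts B) := by
  refine ⟨Set.ext fun ⟨β, B⟩ => mem_blowup_iff_isAdapted, ?_⟩
  rintro β ⟨h, Q, hs⟩
  refine ⟨fun hc => exists_isJoin hs hc, fun hc hL => ?_,
    fun hL => mem_blowup_iff_of_isLinePairAt hs hL⟩
  rw [hs.isLinePairAt_iff hc] at hL
  push Not at hL
  obtain ⟨v, hv, hQv⟩ := hL
  refine ⟨?_, conicTangent h Q c.rep, isTangentLine_iff hs hc hv hQv,
    mem_blowup_iff_exists_plane hs hc hv hQv⟩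
  rw [curveSpan_eq_plane hs hc hv hQv, finrank_plane hs.ne_zero]
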